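/- Consider a rank-one (cutting and stacking) construction: let $q_0\ge 1$, let $(r_m)_{m\ge 0}$ be integers with $r_m\ge 2$, and let $s^{(m)}_1,\dots,s^{(m)}_{r_m}\ge 0$ be integers. The tower $C_0$ consists of $q_0$ pairwise disjoint intervals (levels) of equal length. Given the tower $C_m$, which consists of $q_m$ pairwise disjoint intervals of equal length, cut it into $r_m$ subcolumns $C_m(1),\dots,C_m(r_m)$ of equal width (numbered from left to right), place $s^{(m)}_i$ spacers (new disjoint intervals, as wide as the subcolumn) over $C_m(i)$, and stack the resulting columns, each $C_m(i)$ with its spacers lying below $C_m(i+1)$, to obtain the tower $C_{m+1}$ of height $q_{m+1}=r_mq_m+\sum_{i=1}^{r_m}s^{(m)}_i$. The transformation $T$ maps every level of every $C_m$, except the top one, by translation onto the level above it. Assume that the union of all towers has finite Lebesgue measure, and let $\mu$ be the normalized Lebesgue measure on it. Let $r\ge 4$ be an even integer and let $n_0<n_1<\dots$ be integers such that $r_{n_k}=r$ for all $k$ and $r_{n_k+1}\to\infty$ as $k\to\infty$. Suppose that for every $k$, at each of the two steps $m=n_k$ and $m=n_k+1$, exactly one spacer is placed over $C_m(i)$ for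 $\lfloor r_m/2\rfloor+1\le i\le r_m$ and no spacer over $C_m(i)$ for $1\le i\le \lfloor r_m/2\rfloor$. (The construction at all other steps is arbitrary.) Then $T$ is (up to null sets) an automorphism of the probability space on which $\mu$ lives, and it is not reversible: there is no measure-preserving $S$ with $S^2=\mathrm{Id}$ and $T\circ S=S\circ T^{-1}$ $\mu$-almost everywhere. Moreover, writing $\mu_{S_1,S_2}$ for the measure given by $\mu_{S_1,S_2}(A\times B\times C)=\mu(S_1^{-1}A\cap S_2^{-1}B\cap C)$, one has, for all measurable $A,B,C$, as $k\to\infty$, $$\mu_{T^{2q_{n_k}},T^{q_{n_k}}}(A\times B\times C)\to\sum_{(a,b)}P(a,b)\,\mu_{T^{-a},T^{-b}}(A\times B\times C),$$ where $P$ is the probability measure on $\mathbb{Z}^2$ given by $$P=\tfrac{r-2}{2r}\delta_{(0,0)}+\tfrac1{2r}\delta_{(1,1)}+\tfrac1{2r}\delta_{(2,2)}+\tfrac1r\delta_{(1,0)}+\tfrac{r-3}{2r}\delta_{(2,1)}+\tfrac1{2r}\delta_{(3,1)}.$$ -/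

import Mathlib

open MeasureTheory Filter Topology Set

noncomputable section

/-- Parameters of a rank-one (cutting and stacking) construction. Stages and subcolumns are counted
from `0`: at stage `n` the tower is cut into `cuts n` subcolumns, and `spacers n i` spacers are put
over the subcolumn with index `i < cuts n` (values at `i ≥ cuts n` are never used). The initial
tower has `height₀` levels. -/
structure CutStack where
  height₀ : ℕ
  cuts : ℕ → ℕ
  spacers : ℕ → ℕ → ℕ
  height₀_pos : 1 ≤ height₀
  two_le_cuts : ∀ n, 2 ≤ cuts n

namespace CutStack

variable (c : CutStack)

/-- The height `q n` of the `n`-th tower. -/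
def height : ℕ → ℕ
  | 0 => c.height₀
  | n + 1 => c.cuts n * height n + ∑ i ∈ Finset.range (c.cuts n), c.spacers n i

/-- The common length of the levels of the `n`-th tower (levels of the initial tower have
length `1`). -/
def width : ℕ → ℝ
  | 0 => 1
  | n + 1 => width n / c.cuts n

/-- The number of spacers used at stage `n` over the subcolumns with index `< i`. -/
def spacersBefore (n i : ℕ) : ℕ := ∑ m ∈ Finset.range i, c.spacers n m

/-- The index, in tower `n + 1`, of the bottom level of the `i`-th subcolumn of tower `n`:
below it are `i` subcolumns of tower `n`, together with their spacers. -/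
def colStart (n i : ℕ) : ℕ := i * c.height n + c.spacersBefore n i

/-- The index of the subcolumn of tower `n` to which (or to the spacers over which) the level
number `p` of tower `n + 1` belongs. -/
def colIndex (n p : ℕ) : ℕ := Nat.findGreatest (fun i => c.colStart n i ≤ p) (c.cuts n - 1)

/-- The left endpoint of the level number `p` (`0 ≤ p < height n`, from the bottom) of tower `n`.
Tower `0` consists of the intervals `[p, p + 1)`. Each level `[a, a + width n)` of tower `n` is cut
into the intervals `[a + i * width (n + 1), a + (i + 1) * width (n + 1))`, `i < cuts n`, which belong
to the successive subcolumns. The spacers of stage `n` are successive intervals of length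
`width (n + 1)` to the right of tower `n`, which fills `[0, height n * width n)`. -/
def left : ℕ → ℕ → ℝ
  | 0, p => p
  | n + 1, p =>
    let i := c.colIndex n p
    let j := p - c.colStart n i
    if j < c.height n then left n j + i * c.width (n + 1)
    else c.height n * c.width n
      + ((c.spacersBefore n i : ℝ) + ((j - c.height n : ℕ) : ℝ)) * c.width (n + 1)

/-- The level number `p` of tower `n`. -/
def level (n p : ℕ) : Set ℝ := Ico (c.left n p) (c.left n p + c.width n)

/-- The space on which the transformation lives: the union of all levels of all towers. -/
def space : Set ℝ := ⋃ n, ⋃ p ∈ Finset.range (c.height n), c.level n p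

/-- Lebesgue measure on `c.space`, normalized to be a probability measure
(when `c.space` has finite Lebesgue measure). -/
def measure : Measure ℝ := (volume c.space)⁻¹ • volume.restrict c.space

open Classical in
/-- The rank-one transformation: each level of each tower, except the top one, is translated onto
the level above it. The translations at different stages are compatible, so the choice of the stage
is immaterial. The map is the identity on the remaining points, which form a null set in
`c.space`. -/
def map (x : ℝ) : ℝ :=
  if h : ∃ np : ℕ × ℕ, np.2 + 1 < c.height np.1 ∧ x ∈ c.level np.1 np.2 then
    x - c.left h.choose.1 h.choose.2 + c.left h.choose.1 (h.choose.2 + 1)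
  else x

end CutStack

/-- `T` is an automorphism of the measure space `(X, μ)` (an invertible measure-preserving map, up to
null sets) and `T'` is its inverse. -/
structure IsAutomorphismWithInverse {X : Type*} [MeasurableSpace X] (μ : Measure X)
    (T T' : X → X) : Prop where
  measurePreserving : MeasurePreserving T μ μ
  measurePreserving_inverse : MeasurePreserving T' μ μ
  left_inverse : T' ∘ T =ᵐ[μ] id
  right_inverse : T ∘ T' =ᵐ[μ] id

/-- An automorphism `T` is reversible if `T ∘ S = S ∘ T⁻¹` for some automorphism `S` with
`S ∘ S = id` (all up to null sets). -/
def IsReversible {X : Type*} [MeasurableSpace X] (μ : Measure X) (T : X → X) : Prop :=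
  ∃ T' S : X → X, IsAutomorphismWithInverse μ T T' ∧ MeasurePreserving S μ μ ∧
    S ∘ S =ᵐ[μ] id ∧ T ∘ S =ᵐ[μ] S ∘ T'

/-- The off-diagonal 3-self-joining `μ_{S₁,S₂}`, the image of `μ` under `x ↦ (S₁ x, S₂ x, x)`, so that
`μ_{S₁,S₂}(A × B × C) = μ(S₁⁻¹ A ∩ S₂⁻¹ B ∩ C)`. -/
def offDiagonalJoining {X : Type*} [MeasurableSpace X] (μ : Measure X) (S₁ S₂ : X → X) :
    Measure (X × X × X) :=
  μ.map (fun x => (S₁ x, S₂ x, x))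

end

/-! Write `n` for a stage `n k` and `q` for its height. From level `j` of `C_n`, inside column `i`,
going up `q` levels leads to the next column, lower by the number of spacers crossed. So `T^q` acts
on column `i` like `T^{-lag}`, where the lag is `0` on the left half of the columns and `1` on the
right half. Leaving the last column, the orbit also crosses the `e` spacers put at stage `n + 1`
over the current column of `C_{n+1}`. Since `r_{n+1} → ∞`, the values `e = 0` and `e = 1` each occur
asymptotically on half of the space. Likewise `T^{2q}` acts like `T^{-lagTwo}`, with the sum of two
consecutive lags.

The `2r` blocks given by the pairs `(i, e)` asymptotically partition the space, and each is
asymptotically independent of any fixed set, with weight `1/(2r)`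
(`tendsto_measureReal_inter_block`). On a block the powers of `T` may be replaced by powers of the
inverse (`tendsto_measureReal_symmDiff_inter`). Summing over the blocks gives the limit
(`tendsto_measureReal_preimage_iterate`), and counting the pairs of lags gives `P` (`sum_lag`).

If `S` reversed `T`, conjugation by `S` would exchange the first and third coordinates of `(T^{2q}
x, T^q x, x)`. The limit would then be unchanged under `(a, b) ↦ (a, a - b)`. But `P` charges `(2,
2)` and not `(2, 0)`; levels of `C_2` detect the difference (`not_isReversible`). -/

open scoped symmDiff

noncomputable section

/-! ### Heights, widths and positions of the columns. -/

namespace CutStack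

variable (c : CutStack)

lemma cuts_pos (n : ℕ) : 0 < c.cuts n := by have := c.two_le_cuts n; omega

lemma height_pos (n : ℕ) : 0 < c.height n := by
  induction n with
  | zero => exact c.height₀_pos
  | succ n ih => exact Nat.add_pos_left (Nat.mul_pos (c.cuts_pos n) ih) _

lemma two_pow_le_height (n : ℕ) : 2 ^ n ≤ c.height n := by
  induction n with
  | zero => exact c.height₀_pos
  | succ n ih =>
    calc 2 ^ (n + 1) = 2 * 2 ^ n := by ring
      _ ≤ c.cuts n * c.height n := Nat.mul_le_mul (c.two_le_cuts n) ih
      _ ≤ _ := Nat.le_add_right _ _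

lemma width_pos (n : ℕ) : 0 < c.width n := by
  induction n with
  | zero => exact one_pos
  | succ n ih => exact div_pos ih (by exact_mod_cast c.cuts_pos n)

lemma width_eq (n : ℕ) : c.width n = c.cuts n * c.width (n + 1) := by
  have : (c.cuts n : ℝ) ≠ 0 := by exact_mod_cast (c.cuts_pos n).ne'
  simp only [width]
  field_simp

lemma width_le (n : ℕ) : c.width n ≤ (1 / 2) ^ n := by
  induction n with
  | zero => simp [width]
  | succ n ih =>
    have h2 : (2 : ℝ) ≤ c.cuts n := by exact_mod_cast c.two_le_cuts n
    have := c.width_eq n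
    have := c.width_pos (n + 1)
    rw [pow_succ]
    nlinarith

lemma tendsto_width : Tendsto c.width atTop (𝓝 0) :=
  squeeze_zero (fun n => (c.width_pos n).le) c.width_le
    (tendsto_pow_atTop_nhds_zero_of_lt_one (by norm_num) (by norm_num))

lemma exists_width_eq {m n : ℕ} (h : m ≤ n) : ∃ M : ℕ, c.width m = M * c.width n := by
  induction n, h using Nat.le_induction with
  | base => exact ⟨1, by simp⟩
  | succ n _ ih =>
    obtain ⟨M, hM⟩ := ih
    exact ⟨M * c.cuts n, by rw [hM, c.width_eq n]; push_cast; ring⟩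

lemma colStart_zero (n : ℕ) : c.colStart n 0 = 0 := by simp [colStart, spacersBefore]

lemma colStart_succ (n i : ℕ) :
    c.colStart n (i + 1) = c.colStart n i + (c.height n + c.spacers n i) := by
  simp only [colStart, spacersBefore, Finset.sum_range_succ]
  ring

lemma colStart_cuts (n : ℕ) : c.colStart n (c.cuts n) = c.height (n + 1) := rfl

lemma colStart_strictMono (n : ℕ) : StrictMono (c.colStart n) :=
  strictMono_nat_of_lt_succ fun i => by
    have := c.height_pos n
    rw [colStart_succ]
    omega

lemma spacersBefore_mono (n : ℕ) : Monotone (c.spacersBefore n) :=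
  monotone_nat_of_le_succ fun i => by simp [spacersBefore, Finset.sum_range_succ]

lemma colIndex_colStart_add {n i j : ℕ} (hi : i < c.cuts n) (hj : j < c.height n + c.spacers n i) :
    c.colIndex n (c.colStart n i + j) = i := by
  rw [colIndex, Nat.findGreatest_eq_iff]
  refine ⟨by omega, fun _ => Nat.le_add_right _ _, fun k hk _ => ?_⟩
  have := (c.colStart_strictMono n).monotone (show i + 1 ≤ k from hk)
  rw [colStart_succ] at this
  omega

lemma exists_colStart_add {n p : ℕ} (hp : p < c.height (n + 1)) :
    ∃ i < c.cuts n, ∃ j < c.height n + c.spacers n i, p = c.colStart n i + j := by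
  have hc := c.cuts_pos n
  have h0 : c.colStart n (c.colIndex n p) ≤ p :=
    Nat.findGreatest_spec (P := fun i => c.colStart n i ≤ p) (Nat.zero_le (c.cuts n - 1))
      (by simp [colStart_zero])
  have h1 : c.colIndex n p ≤ c.cuts n - 1 := Nat.findGreatest_le _
  have h2 : p < c.colStart n (c.colIndex n p + 1) := by
    by_cases h : c.colIndex n p + 1 ≤ c.cuts n - 1
    · by_contra h'
      exact Nat.findGreatest_is_greatest (P := fun i => c.colStart n i ≤ p)
        (Nat.lt_succ_self (c.colIndex n p)) h (not_lt.1 h')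
    · have : c.colIndex n p + 1 = c.cuts n := by omega
      rwa [this, colStart_cuts]
  rw [colStart_succ] at h2
  exact ⟨c.colIndex n p, by omega, p - c.colStart n (c.colIndex n p), by omega, by omega⟩

lemma colStart_add_lt {n i j : ℕ} (hi : i < c.cuts n) (hj : j < c.height n + c.spacers n i) :
    c.colStart n i + j < c.height (n + 1) := by
  have := (c.colStart_strictMono n).monotone (show i + 1 ≤ c.cuts n from hi)
  rw [colStart_succ, colStart_cuts] at this
  omega

/-! ### Levels as disjoint intervals, towers and columns. -/

/-- The position of the level number `p` of tower `n` on the real line, counted in units of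
`width n`. -/
def pos : ℕ → ℕ → ℕ
  | 0, p => p
  | n + 1, p =>
    let i := c.colIndex n p
    let j := p - c.colStart n i
    if j < c.height n then pos n j * c.cuts n + i
    else c.height n * c.cuts n + (c.spacersBefore n i + (j - c.height n))

lemma left_eq (n p : ℕ) : c.left n p = c.pos n p * c.width n := by
  induction n generalizing p with
  | zero => simp [left, pos, width]
  | succ n ih =>
    simp only [left, pos]
    split_ifs
    · rw [ih, c.width_eq n]; push_cast; ring
    · rw [c.width_eq n]; push_cast; ring

lemma pos_succ {n i j : ℕ} (hi : i < c.cuts n) (hj : j < c.height n + c.spacers n i) :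
    c.pos (n + 1) (c.colStart n i + j) = if j < c.height n then c.pos n j * c.cuts n + i
      else c.height n * c.cuts n + (c.spacersBefore n i + (j - c.height n)) := by
  simp only [pos, c.colIndex_colStart_add hi hj, Nat.add_sub_cancel_left]

lemma left_succ {n i j : ℕ} (hi : i < c.cuts n) (hj : j < c.height n) :
    c.left (n + 1) (c.colStart n i + j) = c.left n j + i * c.width (n + 1) := by
  rw [left_eq, c.pos_succ hi (by omega), if_pos hj, left_eq, c.width_eq n]
  push_cast; ring

lemma pos_lt {n p : ℕ} (hp : p < c.height n) : c.pos n p < c.height n := by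
  induction n generalizing p with
  | zero => exact hp
  | succ n ih =>
    obtain ⟨i, hi, j, hj, rfl⟩ := c.exists_colStart_add hp
    rw [c.pos_succ hi hj]
    have hh : c.height (n + 1) = c.height n * c.cuts n + c.spacersBefore n (c.cuts n) := by
      simp [height, spacersBefore, mul_comm]
    split_ifs with h
    · have := ih h
      nlinarith
    · have := c.spacersBefore_mono n (show i + 1 ≤ c.cuts n from hi)
      simp only [spacersBefore, Finset.sum_range_succ] at this hh ⊢
      omega

/-- Positions below `height n * cuts n` belong to cut levels and the later ones to spacers, so the
two kinds never collide; within each kind the column and the level can be recovered. -/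
lemma pos_inj {n p p' : ℕ} (hp : p < c.height n) (hp' : p' < c.height n)
    (h : c.pos n p = c.pos n p') : p = p' := by
  induction n generalizing p p' with
  | zero => exact h
  | succ n ih =>
    obtain ⟨i, hi, j, hj, rfl⟩ := c.exists_colStart_add hp
    obtain ⟨i', hi', j', hj', rfl⟩ := c.exists_colStart_add hp'
    rw [c.pos_succ hi hj, c.pos_succ hi' hj'] at h
    split_ifs at h with h1 h2 h2
    -- For cut levels, the column is the remainder modulo `cuts n`.
    · have hm := congrArg (· % c.cuts n) h
      have hd := congrArg (· / c.cuts n) h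
      simp only [Nat.mul_add_mod', Nat.mod_eq_of_lt hi, Nat.mod_eq_of_lt hi'] at hm
      subst hm
      have : c.pos n j * c.cuts n = c.pos n j' * c.cuts n := by omega
      rw [ih h1 h2 (Nat.eq_of_mul_eq_mul_right (c.cuts_pos n) this)]
    · have := c.pos_lt h1
      nlinarith
    · have := c.pos_lt h2
      nlinarith
    · have key : ∀ a b : ℕ, a < b → c.spacersBefore n a + c.spacers n a ≤ c.spacersBefore n b := by
        intro a b hab
        have := c.spacersBefore_mono n (show a + 1 ≤ b from hab)
        simpa only [spacersBefore, Finset.sum_range_succ] using this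
      rcases lt_trichotomy i i' with hlt | rfl | hlt
      · have := key _ _ hlt
        omega
      · omega
      · have := key _ _ hlt
        omega

lemma mem_level_iff {n p : ℕ} {x : ℝ} :
    x ∈ c.level n p ↔ c.pos n p * c.width n ≤ x ∧ x < (c.pos n p + 1) * c.width n := by
  rw [level, left_eq, mem_Ico, add_mul, one_mul]

lemma eq_of_mem_level {n p p' : ℕ} {x : ℝ} (hp : p < c.height n) (hp' : p' < c.height n)
    (hx : x ∈ c.level n p) (hx' : x ∈ c.level n p') : p = p' := by
  rw [mem_level_iff] at hx hx'
  have hw := c.width_pos n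
  have h1 : (c.pos n p : ℝ) < c.pos n p' + 1 := lt_of_mul_lt_mul_right (hx.1.trans_lt hx'.2) hw.le
  have h2 : (c.pos n p' : ℝ) < c.pos n p + 1 := lt_of_mul_lt_mul_right (hx'.1.trans_lt hx.2) hw.le
  norm_cast at h1 h2
  exact c.pos_inj hp hp' (by omega)

lemma measurableSet_level (n p : ℕ) : MeasurableSet (c.level n p) := measurableSet_Ico

lemma volume_level (n p : ℕ) : volume (c.level n p) = ENNReal.ofReal (c.width n) := by
  simp [level]

lemma pairwiseDisjoint_level (n : ℕ) :
    (Finset.range (c.height n) : Set ℕ).PairwiseDisjoint (c.level n) := by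
  intro p hp p' hp' hne
  refine Set.disjoint_left.2 fun x hx hx' => hne ?_
  exact c.eq_of_mem_level (by simpa using hp) (by simpa using hp') hx hx'

lemma level_succ_subset {n i j : ℕ} (hi : i < c.cuts n) (hj : j < c.height n) :
    c.level (n + 1) (c.colStart n i + j) ⊆ c.level n j := by
  rw [level, level, c.left_succ hi hj]
  have hw := c.width_pos (n + 1)
  have hi' : (i : ℝ) + 1 ≤ c.cuts n := by exact_mod_cast hi
  rw [c.width_eq n]
  refine Ico_subset_Ico ?_ ?_
  · have : 0 ≤ (i : ℝ) * c.width (n + 1) := by positivity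
    linarith
  · nlinarith

lemma exists_mem_level_succ {n j : ℕ} {x : ℝ} (hj : j < c.height n) (hx : x ∈ c.level n j) :
    ∃ i < c.cuts n, x ∈ c.level (n + 1) (c.colStart n i + j) := by
  have hw := c.width_pos (n + 1)
  rw [level, c.width_eq n] at hx
  have h0 : 0 ≤ (x - c.left n j) / c.width (n + 1) := div_nonneg (by linarith [hx.1]) hw.le
  have h1 : (x - c.left n j) / c.width (n + 1) < c.cuts n := by
    rw [div_lt_iff₀ hw]; linarith [hx.2]
  have hi := (Nat.floor_lt h0).2 h1
  refine ⟨_, hi, ?_⟩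
  rw [level, c.left_succ hi hj]
  have h2 := Nat.floor_le h0
  have h3 := Nat.lt_floor_add_one ((x - c.left n j) / c.width (n + 1))
  rw [le_div_iff₀ hw] at h2
  rw [div_lt_iff₀ hw] at h3
  constructor <;> linarith

/-- The union of the levels of tower `n`. -/
def tower (n : ℕ) : Set ℝ := ⋃ p ∈ Finset.range (c.height n), c.level n p

lemma mem_tower {n : ℕ} {x : ℝ} : x ∈ c.tower n ↔ ∃ p < c.height n, x ∈ c.level n p := by
  simp [tower]

lemma tower_mono : Monotone c.tower := by
  refine monotone_nat_of_le_succ fun n x hx => ?_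
  obtain ⟨p, hp, hx⟩ := c.mem_tower.1 hx
  obtain ⟨i, hi, hx⟩ := c.exists_mem_level_succ hp hx
  exact c.mem_tower.2 ⟨_, c.colStart_add_lt hi (by omega), hx⟩

lemma measurableSet_tower (n : ℕ) : MeasurableSet (c.tower n) :=
  Finset.measurableSet_biUnion _ fun p _ => c.measurableSet_level n p

lemma space_eq_iUnion_tower : c.space = ⋃ n, c.tower n := rfl

lemma measurableSet_space : MeasurableSet c.space := .iUnion c.measurableSet_tower

lemma tower_subset_space (n : ℕ) : c.tower n ⊆ c.space := subset_iUnion c.tower n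

lemma level_subset_tower {n p : ℕ} (hp : p < c.height n) : c.level n p ⊆ c.tower n :=
  fun _ hx => c.mem_tower.2 ⟨p, hp, hx⟩

/-- The subcolumn with index `i` of tower `n`. -/
def column (n i : ℕ) : Set ℝ :=
  ⋃ j ∈ Finset.range (c.height n), c.level (n + 1) (c.colStart n i + j)

lemma mem_column {n i : ℕ} {x : ℝ} :
    x ∈ c.column n i ↔ ∃ j < c.height n, x ∈ c.level (n + 1) (c.colStart n i + j) := by
  simp [column]

lemma measurableSet_column (n i : ℕ) : MeasurableSet (c.column n i) :=
  Finset.measurableSet_biUnion _ fun _ _ => c.measurableSet_level _ _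

lemma eq_of_mem_column {n i i' : ℕ} {x : ℝ} (hi : i < c.cuts n) (hi' : i' < c.cuts n)
    (hx : x ∈ c.column n i) (hx' : x ∈ c.column n i') : i = i' := by
  obtain ⟨j, hj, hx⟩ := c.mem_column.1 hx
  obtain ⟨j', hj', hx'⟩ := c.mem_column.1 hx'
  have := c.eq_of_mem_level (c.colStart_add_lt hi (by omega)) (c.colStart_add_lt hi' (by omega))
    hx hx'
  rw [← c.colIndex_colStart_add hi (show j < _ + _ by omega), this,
    c.colIndex_colStart_add hi' (by omega)]

lemma column_subset_tower {n i : ℕ} (hi : i < c.cuts n) : c.column n i ⊆ c.tower n := by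
  intro x hx
  obtain ⟨j, hj, hx⟩ := c.mem_column.1 hx
  exact c.level_subset_tower hj (c.level_succ_subset hi hj hx)

/-- A point of the level `j` which lies in the column `i` is in the level `colStart n i + j` of the
next tower. -/
lemma mem_level_succ_of_mem_column {n i j : ℕ} {x : ℝ} (hi : i < c.cuts n) (hj : j < c.height n)
    (hx : x ∈ c.level n j) (hx' : x ∈ c.column n i) :
    x ∈ c.level (n + 1) (c.colStart n i + j) := by
  obtain ⟨j', hj', hx'⟩ := c.mem_column.1 hx'
  rwa [c.eq_of_mem_level hj hj' hx (c.level_succ_subset hi hj' hx')]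

end CutStack

/-! ### The transformation and its inverse as an automorphism. -/

lemma measurable_of_iUnion_of_eqOn {ι X : Type*} [Countable ι] [MeasurableSpace X] {D : ι → Set X}
    {f : X → X} {g : ι → X → X} (hD : ∀ i, MeasurableSet (D i)) (hg : ∀ i, Measurable (g i))
    (hf : ∀ i, EqOn f (g i) (D i)) (hid : ∀ x, x ∉ ⋃ i, D i → f x = x) : Measurable f := by
  intro A hA
  have : f ⁻¹' A = (⋃ i, D i ∩ g i ⁻¹' A) ∪ ((⋃ i, D i)ᶜ ∩ A) := by
    ext x
    simp only [mem_preimage, mem_union, mem_iUnion, mem_inter_iff, mem_compl_iff]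
    by_cases h : ∃ i, x ∈ D i
    · simp only [h, not_true_eq_false, false_and, or_false]
      constructor
      · intro hx
        obtain ⟨i, hi⟩ := h
        exact ⟨i, hi, by rwa [← hf i hi]⟩
      · rintro ⟨i, hi, hx⟩
        rwa [hf i hi]
    · have h' := hid x (by simpa using h)
      push Not at h
      simp [h, h']
  rw [this]
  exact (MeasurableSet.iUnion fun i => (hD i).inter (hg i hA)).union
    ((MeasurableSet.iUnion hD).compl.inter hA)

namespace CutStack

variable (c : CutStack)

open Classical in
/-- The inverse transformation: each level of each tower, except the bottom one, is translated onto
the level below it. -/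
def inv (x : ℝ) : ℝ :=
  if h : ∃ np : ℕ × ℕ, np.2 + 1 < c.height np.1 ∧ x ∈ c.level np.1 (np.2 + 1) then
    x - c.left h.choose.1 (h.choose.2 + 1) + c.left h.choose.1 h.choose.2
  else x

/-- For `e = 0` and `e = 1`: the translation from level `p` to level `p + 1` of tower `m` is also one
of tower `n ≥ m`. -/
lemma exists_level_of_le {m n p e : ℕ} {x : ℝ} (h : m ≤ n) (he : e ≤ 1) (hp : p + 1 < c.height m)
    (hx : x ∈ c.level m (p + e)) : ∃ p', p' + 1 < c.height n ∧ x ∈ c.level n (p' + e) ∧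
      c.left n (p' + 1) - c.left n p' = c.left m (p + 1) - c.left m p := by
  induction n, h using Nat.le_induction with
  | base => exact ⟨p, hp, hx, rfl⟩
  | succ n _ ih =>
    obtain ⟨p', hp', hx', h⟩ := ih
    obtain ⟨i, hi, hx''⟩ := c.exists_mem_level_succ (by omega) hx'
    refine ⟨c.colStart n i + p', ?_, ?_, ?_⟩
    · rw [add_assoc]
      exact c.colStart_add_lt hi (by omega)
    · rwa [add_assoc]
    · rw [add_assoc, c.left_succ hi hp', c.left_succ hi (by omega), ← h]
      ring

/-- Both translations reappear in the tower `max m n`, where the level containing `x` is unique.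
This makes the choice of stage in `map` and `inv` immaterial. -/
lemma left_sub_left_eq {m n p p' e : ℕ} {x : ℝ} (he : e ≤ 1) (hp : p + 1 < c.height m)
    (hx : x ∈ c.level m (p + e)) (hp' : p' + 1 < c.height n) (hx' : x ∈ c.level n (p' + e)) :
    c.left m (p + 1) - c.left m p = c.left n (p' + 1) - c.left n p' := by
  obtain ⟨P, hP, hxP, h⟩ := c.exists_level_of_le (le_max_left m n) he hp hx
  obtain ⟨P', hP', hxP', h'⟩ := c.exists_level_of_le (le_max_right m n) he hp' hx'
  have := c.eq_of_mem_level (by omega) (by omega) hxP hxP'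
  obtain rfl : P = P' := by omega
  rw [← h, ← h']

lemma map_eq {n p : ℕ} {x : ℝ} (hp : p + 1 < c.height n) (hx : x ∈ c.level n p) :
    c.map x = x - c.left n p + c.left n (p + 1) := by
  have h : ∃ np : ℕ × ℕ, np.2 + 1 < c.height np.1 ∧ x ∈ c.level np.1 np.2 := ⟨(n, p), hp, hx⟩
  rw [map, dif_pos h]
  have := c.left_sub_left_eq (zero_le_one) h.choose_spec.1 h.choose_spec.2 hp hx
  linarith

lemma inv_eq {n p : ℕ} {x : ℝ} (hp : p + 1 < c.height n) (hx : x ∈ c.level n (p + 1)) :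
    c.inv x = x - c.left n (p + 1) + c.left n p := by
  have h : ∃ np : ℕ × ℕ, np.2 + 1 < c.height np.1 ∧ x ∈ c.level np.1 (np.2 + 1) :=
    ⟨(n, p), hp, hx⟩
  rw [inv, dif_pos h]
  have := c.left_sub_left_eq le_rfl h.choose_spec.1 h.choose_spec.2 hp hx
  linarith

lemma map_mem_level {n p : ℕ} {x : ℝ} (hp : p + 1 < c.height n) (hx : x ∈ c.level n p) :
    c.map x ∈ c.level n (p + 1) := by
  rw [c.map_eq hp hx]
  constructor <;> linarith [hx.1, hx.2]

lemma inv_mem_level {n p : ℕ} {x : ℝ} (hp : p + 1 < c.height n) (hx : x ∈ c.level n (p + 1)) :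
    c.inv x ∈ c.level n p := by
  rw [c.inv_eq hp hx]
  constructor <;> linarith [hx.1, hx.2]

lemma inv_map {n p : ℕ} {x : ℝ} (hp : p + 1 < c.height n) (hx : x ∈ c.level n p) :
    c.inv (c.map x) = x := by
  rw [c.inv_eq hp (c.map_mem_level hp hx), c.map_eq hp hx]
  ring

lemma map_inv {n p : ℕ} {x : ℝ} (hp : p + 1 < c.height n) (hx : x ∈ c.level n (p + 1)) :
    c.map (c.inv x) = x := by
  rw [c.map_eq hp (c.inv_mem_level hp hx), c.inv_eq hp hx]
  ring

lemma iterate_map_mem_level {n p a : ℕ} {x : ℝ} (hp : p + a < c.height n) (hx : x ∈ c.level n p) :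
    c.map^[a] x ∈ c.level n (p + a) := by
  induction a with
  | zero => exact hx
  | succ a ih =>
    rw [Function.iterate_succ_apply']
    exact c.map_mem_level hp (ih (by omega))

lemma iterate_inv_mem_level {n p a : ℕ} {x : ℝ} (hp : p + a < c.height n)
    (hx : x ∈ c.level n (p + a)) : c.inv^[a] x ∈ c.level n p := by
  induction a generalizing x with
  | zero => exact hx
  | succ a ih => exact ih (by omega) (c.inv_mem_level hp hx)

/-- The union of the levels of tower `n` without the top level (`e = 0`) or without the bottom level
(`e = 1`). -/
def innerTower (e n : ℕ) : Set ℝ :=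
  ⋃ p ∈ Finset.range (c.height n - 1), c.level n (p + e)

lemma mem_innerTower {e n : ℕ} {x : ℝ} :
    x ∈ c.innerTower e n ↔ ∃ p, p + 1 < c.height n ∧ x ∈ c.level n (p + e) := by
  simp [innerTower, Nat.lt_sub_iff_add_lt]

lemma innerTower_mono {e : ℕ} (he : e ≤ 1) : Monotone (c.innerTower e) := by
  intro m n h x hx
  obtain ⟨p, hp, hx⟩ := c.mem_innerTower.1 hx
  obtain ⟨p', hp', hx', -⟩ := c.exists_level_of_le h he hp hx
  exact c.mem_innerTower.2 ⟨p', hp', hx'⟩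

lemma innerTower_subset_tower {e n : ℕ} (he : e ≤ 1) : c.innerTower e n ⊆ c.tower n := by
  intro x hx
  obtain ⟨p, hp, hx⟩ := c.mem_innerTower.1 hx
  exact c.level_subset_tower (by omega) hx

lemma measurable_map : Measurable c.map := by
  refine measurable_of_iUnion_of_eqOn
    (ι := {np : ℕ × ℕ // np.2 + 1 < c.height np.1})
    (D := fun i => c.level i.1.1 i.1.2)
    (g := fun i x => x - c.left i.1.1 i.1.2 + c.left i.1.1 (i.1.2 + 1))
    (fun i => c.measurableSet_level _ _) (fun i => by fun_prop) (fun i x hx => c.map_eq i.2 hx) ?_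
  intro x hx
  rw [map, dif_neg]
  rintro ⟨np, h, hx'⟩
  exact hx (mem_iUnion.2 ⟨⟨np, h⟩, hx'⟩)

lemma measurable_inv : Measurable c.inv := by
  refine measurable_of_iUnion_of_eqOn
    (ι := {np : ℕ × ℕ // np.2 + 1 < c.height np.1})
    (D := fun i => c.level i.1.1 (i.1.2 + 1))
    (g := fun i x => x - c.left i.1.1 (i.1.2 + 1) + c.left i.1.1 i.1.2)
    (fun i => c.measurableSet_level _ _) (fun i => by fun_prop) (fun i x hx => c.inv_eq i.2 hx) ?_
  intro x hx
  rw [inv, dif_neg]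
  rintro ⟨np, h, hx'⟩
  exact hx (mem_iUnion.2 ⟨⟨np, h⟩, hx'⟩)

lemma volume_space_diff_iUnion_innerTower {e : ℕ} (he : e ≤ 1) :
    volume (c.space \ ⋃ n, c.innerTower e n) = 0 := by
  rw [space_eq_iUnion_tower, iUnion_sdiff, measure_iUnion_null_iff]
  intro m
  have hlim : Tendsto (fun n => ENNReal.ofReal (c.width n)) atTop (𝓝 0) := by
    simpa using ENNReal.tendsto_ofReal c.tendsto_width
  refine le_antisymm (ge_of_tendsto hlim ?_) bot_le
  filter_upwards [eventually_ge_atTop m] with n hn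
  -- The only level of tower `n` missing from `innerTower e n` is the top one for `e = 0` and the
  -- bottom one for `e = 1`. Its measure is `width n`, which tends to `0`.
  rw [← c.volume_level n (if e = 0 then c.height n - 1 else 0)]
  refine measure_mono fun x hx => ?_
  obtain ⟨p, hp, hxp⟩ := c.mem_tower.1 (c.tower_mono hn hx.1)
  have hx' : x ∉ c.innerTower e n := fun h => hx.2 (mem_iUnion.2 ⟨n, h⟩)
  rw [mem_innerTower] at hx'
  push Not at hx'
  split_ifs with h0
  · subst h0
    by_cases hp' : p + 1 < c.height n
    · exact absurd hxp (hx' p hp')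
    · rwa [show c.height n - 1 = p by omega]
  · obtain rfl : e = 1 := by omega
    obtain _ | p := p
    · exact hxp
    · exact absurd hxp (hx' p hp)

lemma tendsto_volume_inter_innerTower {e : ℕ} (he : e ≤ 1) (B : Set ℝ) :
    Tendsto (fun n => volume (B ∩ c.innerTower e n)) atTop (𝓝 (volume (B ∩ c.space))) := by
  have h := tendsto_measure_iUnion_atTop (μ := volume) (s := fun n => B ∩ c.innerTower e n)
    (fun m n hmn => inter_subset_inter_right B (c.innerTower_mono he hmn))
  have hae : (B ∩ ⋃ n, c.innerTower e n : Set ℝ) =ᵐ[volume] (B ∩ c.space : Set ℝ) := by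
    refine (ae_eq_refl B).inter ?_
    refine (LE.le.eventuallyLE ?_).antisymm
      (ae_le_set.2 (c.volume_space_diff_iUnion_innerTower he))
    exact iUnion_subset fun n => (c.innerTower_subset_tower he).trans (c.tower_subset_space n)
  rwa [← inter_iUnion, measure_congr hae] at h

lemma volume_preimage_map_inter_level {n p : ℕ} (A : Set ℝ) (hp : p + 1 < c.height n) :
    volume (c.map ⁻¹' A ∩ c.level n p) = volume (A ∩ c.level n (p + 1)) := by
  have : c.map ⁻¹' A ∩ c.level n p =
      (fun x => x + (c.left n (p + 1) - c.left n p)) ⁻¹' (A ∩ c.level n (p + 1)) := by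
    ext x
    have hl : x ∈ c.level n p ↔ x + (c.left n (p + 1) - c.left n p) ∈ c.level n (p + 1) := by
      simp only [level, mem_Ico]
      constructor <;> rintro ⟨h1, h2⟩ <;> constructor <;> linarith
    rw [mem_inter_iff, mem_preimage, mem_preimage, mem_inter_iff, ← hl]
    refine and_congr_left fun hx => ?_
    rw [c.map_eq hp hx, add_sub_assoc', sub_add_eq_add_sub]
  rw [this, measure_preimage_add_right]

lemma volume_inter_innerTower (e n : ℕ) (he : e ≤ 1) {B : Set ℝ} (hB : MeasurableSet B) :
    volume (B ∩ c.innerTower e n) =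
      ∑ p ∈ Finset.range (c.height n - 1), volume (B ∩ c.level n (p + e)) := by
  rw [innerTower, inter_iUnion₂, measure_biUnion_finset]
  · intro p hp p' hp' hne
    refine Set.disjoint_left.2 fun x hx hx' => hne ?_
    simp only [Finset.coe_range, mem_Iio] at hp hp'
    have := c.eq_of_mem_level (by omega) (by omega) hx.2 hx'.2
    omega
  · exact fun p _ => hB.inter (c.measurableSet_level _ _)

/-- On tower `n` without its top level, `map` is a translation level by level, onto the tower
without its bottom level. Both exhaust the space up to a null set as `n → ∞`. -/
lemma volume_preimage_map_inter_space {A : Set ℝ} (hA : MeasurableSet A) :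
    volume (c.map ⁻¹' A ∩ c.space) = volume (A ∩ c.space) := by
  refine tendsto_nhds_unique (c.tendsto_volume_inter_innerTower zero_le_one (c.map ⁻¹' A)) ?_
  refine (c.tendsto_volume_inter_innerTower le_rfl A).congr fun n => ?_
  rw [c.volume_inter_innerTower 0 n zero_le_one (c.measurable_map hA),
    c.volume_inter_innerTower 1 n le_rfl hA]
  refine Finset.sum_congr rfl fun p hp => (c.volume_preimage_map_inter_level A ?_).symm
  rw [Finset.mem_range] at hp
  omega

lemma volume_space_ne_zero : volume c.space ≠ 0 := by
  have h : volume (c.level 0 0) ≤ volume c.space :=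
    measure_mono ((c.level_subset_tower (c.height_pos 0)).trans (c.tower_subset_space 0))
  rw [volume_level] at h
  have := c.width_pos 0
  exact fun h0 => (ENNReal.ofReal_pos.2 this).ne' (le_antisymm (h0 ▸ h) bot_le)

lemma measure_apply {A : Set ℝ} (hA : MeasurableSet A) :
    c.measure A = (volume c.space)⁻¹ * volume (A ∩ c.space) := by
  rw [measure, Measure.smul_apply, Measure.restrict_apply hA, smul_eq_mul]

lemma isProbabilityMeasure_measure (hfin : volume c.space ≠ ⊤) :
    IsProbabilityMeasure c.measure :=
  ⟨by rw [c.measure_apply .univ, univ_inter,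
    ENNReal.inv_mul_cancel c.volume_space_ne_zero hfin]⟩

lemma measurePreserving_map : MeasurePreserving c.map c.measure c.measure := by
  refine ⟨c.measurable_map, Measure.ext fun A hA => ?_⟩
  rw [Measure.map_apply c.measurable_map hA, c.measure_apply (c.measurable_map hA),
    c.measure_apply hA, c.volume_preimage_map_inter_space hA]

lemma ae_mem_innerTower {e : ℕ} (he : e ≤ 1) :
    ∀ᵐ x ∂c.measure, ∃ n, x ∈ c.innerTower e n := by
  refine Measure.ae_smul_measure ?_ _
  rw [ae_restrict_iff' c.measurableSet_space]
  filter_upwards [measure_eq_zero_iff_ae_notMem.1 (c.volume_space_diff_iUnion_innerTower he)]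
    with x hx hxs
  by_contra h
  exact hx ⟨hxs, by simpa using h⟩

lemma isAutomorphismWithInverse : IsAutomorphismWithInverse c.measure c.map c.inv := by
  have hl : c.inv ∘ c.map =ᵐ[c.measure] id := by
    filter_upwards [c.ae_mem_innerTower zero_le_one] with x hx
    obtain ⟨n, hx⟩ := hx
    obtain ⟨p, hp, hx⟩ := c.mem_innerTower.1 hx
    exact c.inv_map hp hx
  refine ⟨c.measurePreserving_map, ⟨c.measurable_inv, ?_⟩, hl, ?_⟩
  -- The measure is its own image under `map`, and `inv ∘ map` is almost everywhere the identity.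
  · conv_lhs => rw [← c.measurePreserving_map.map_eq]
    rw [Measure.map_map c.measurable_inv c.measurable_map, Measure.map_congr hl, Measure.map_id]
  · filter_upwards [c.ae_mem_innerTower le_rfl] with x hx
    obtain ⟨n, hx⟩ := hx
    obtain ⟨p, hp, hx⟩ := c.mem_innerTower.1 hx
    exact c.map_inv hp hx

end CutStack

/-! ### Limits of measures by density and by partition. -/

lemma abs_measureReal_sub_le {X : Type*} [MeasurableSpace X] (μ : Measure X) [IsFiniteMeasure μ]
    (A B : Set X) : |μ.real A - μ.real B| ≤ μ.real (A ∆ B) := by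
  have key : ∀ A B : Set X, μ.real A ≤ μ.real (A ∆ B) + μ.real B := fun A B =>
    (measureReal_mono (fun x hx => by
      by_cases h : x ∈ B
      · exact Or.inr h
      · exact Or.inl (Or.inl ⟨hx, h⟩))).trans (measureReal_union_le _ _)
  rw [abs_sub_le_iff]
  have h1 := key A B
  have h2 := key B A
  rw [symmDiff_comm] at h2
  constructor <;> linarith

/-- Set functions which are uniformly Lipschitz for the measure of the symmetric difference converge
on all measurable sets if they converge on a dense family. -/
lemma tendsto_of_measureDense {X : Type*} [MeasurableSpace X] {μ : Measure X} [IsFiniteMeasure μ]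
    {𝒜 : Set (Set X)} (h𝒜 : μ.MeasureDense 𝒜) {F : ℕ → Set X → ℝ} {L : Set X → ℝ} {K : ℝ}
    (hF : ∀ k A B, MeasurableSet A → MeasurableSet B → |F k A - F k B| ≤ K * μ.real (A ∆ B))
    (hL : ∀ A B, MeasurableSet A → MeasurableSet B → |L A - L B| ≤ K * μ.real (A ∆ B))
    (h : ∀ A ∈ 𝒜, Tendsto (fun k => F k A) atTop (𝓝 (L A))) {A : Set X} (hA : MeasurableSet A) :
    Tendsto (fun k => F k A) atTop (𝓝 (L A)) := by
  rw [Metric.tendsto_atTop]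
  intro ε hε
  have hK : 0 < |K| + 1 := by positivity
  obtain ⟨B, hB, hAB⟩ := h𝒜.approx A hA (measure_ne_top _ _) (ε / (4 * (|K| + 1))) (by positivity)
  have hBm := h𝒜.measurable B hB
  have hAB' : μ.real (A ∆ B) < ε / (4 * (|K| + 1)) :=
    (ENNReal.lt_ofReal_iff_toReal_lt (measure_ne_top _ _)).1 hAB
  rw [lt_div_iff₀ (by positivity)] at hAB'
  have hKm : K * μ.real (A ∆ B) ≤ (|K| + 1) * μ.real (A ∆ B) :=
    mul_le_mul_of_nonneg_right (by linarith [le_abs_self K]) measureReal_nonneg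
  obtain ⟨N, hN⟩ := Metric.tendsto_atTop.1 (h B hB) (ε / 2) (by positivity)
  refine ⟨N, fun k hk => ?_⟩
  have h1 := hF k A B hA hBm
  have h2 := hL A B hA hBm
  have h3 := hN k hk
  rw [Real.dist_eq, abs_lt] at *
  rw [abs_le] at h1 h2
  constructor <;> linarith [h1.1, h1.2, h2.1, h2.2, h3.1, h3.2]

/-- If finitely many pairwise disjoint sets asymptotically have full measure, then limits of
measures can be computed by summing over these sets. -/
lemma tendsto_measureReal_of_partition {X S : Type*} [MeasurableSpace X] {μ : Measure X}
    [IsProbabilityMeasure μ] (s : Finset S) {Y : ℕ → S → Set X}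
    (hY : ∀ k i, i ∈ s → MeasurableSet (Y k i))
    (hdisj : ∀ k, (s : Set S).PairwiseDisjoint (Y k)) {E : ℕ → Set X} {L M : S → ℝ}
    (hE : ∀ k, MeasurableSet (E k))
    (hL : ∀ i ∈ s, Tendsto (fun k => μ.real (E k ∩ Y k i)) atTop (𝓝 (L i)))
    (hM : ∀ i ∈ s, Tendsto (fun k => μ.real (Y k i)) atTop (𝓝 (M i))) (h1 : ∑ i ∈ s, M i = 1) :
    Tendsto (fun k => μ.real (E k)) atTop (𝓝 (∑ i ∈ s, L i)) := by
  have hU : ∀ k, MeasurableSet (⋃ i ∈ s, Y k i) := fun k => s.measurableSet_biUnion (hY k)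
  have hsum : Tendsto (fun k => ∑ i ∈ s, μ.real (E k ∩ Y k i)) atTop (𝓝 (∑ i ∈ s, L i)) :=
    tendsto_finsetSum _ hL
  have hcompl : Tendsto (fun k => 1 - ∑ i ∈ s, μ.real (Y k i)) atTop (𝓝 0) := by
    simpa [h1] using (tendsto_finsetSum s hM).const_sub 1
  have hrest : Tendsto (fun k => μ.real (E k \ ⋃ i ∈ s, Y k i)) atTop (𝓝 0) := by
    refine squeeze_zero (fun _ => measureReal_nonneg) (fun k => ?_) hcompl
    rw [← measureReal_biUnion_finset (hdisj k) (hY k), ← probReal_compl_eq_one_sub (hU k)]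
    exact measureReal_mono fun x hx => hx.2
  have := hsum.add hrest
  rw [add_zero] at this
  refine this.congr fun k => ?_
  rw [← measureReal_inter_add_sdiff (s := E k) (hU k), inter_iUnion₂, measureReal_biUnion_finset]
  · exact fun i hi j hj hne => (hdisj k hi hj hne).mono inter_subset_right inter_subset_right
  · exact fun i hi => (hE k).inter (hY k i hi)

/-! ### Saturated sets and equidistribution of the blocks. -/

namespace CutStack

variable (c : CutStack)

/-- `A` contains every level of tower `n` which it meets. -/
def Saturated (n : ℕ) (A : Set ℝ) : Prop :=
  ∀ p < c.height n, ∀ x ∈ c.level n p, ∀ y ∈ c.level n p, x ∈ A → y ∈ A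

variable {c} in
lemma Saturated.inter {n : ℕ} {A B : Set ℝ} (hA : c.Saturated n A) (hB : c.Saturated n B) :
    c.Saturated n (A ∩ B) :=
  fun p hp x hx y hy h => ⟨hA p hp x hx y hy h.1, hB p hp x hx y hy h.2⟩

lemma saturated_column {n i : ℕ} (hi : i < c.cuts n) : c.Saturated (n + 1) (c.column n i) := by
  intro p hp x hx y hy h
  obtain ⟨j, hj, h⟩ := c.mem_column.1 h
  obtain rfl := c.eq_of_mem_level hp (c.colStart_add_lt hi (by omega)) hx h
  exact c.mem_column.2 ⟨j, hj, hy⟩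

/-- The measurable sets which are unions of levels at all late stages. -/
def eventuallySaturated : Set (Set ℝ) :=
  {A | MeasurableSet A ∧ ∀ᶠ n in atTop, c.Saturated n A}

lemma isSetAlgebra_eventuallySaturated : IsSetAlgebra c.eventuallySaturated where
  empty_mem := ⟨.empty, .of_forall fun _ _ _ _ _ _ _ h => h⟩
  compl_mem _ hA := ⟨hA.1.compl, hA.2.mono fun _ h p hp x hx y hy hxA hyA =>
    hxA (h p hp y hy x hx hyA)⟩
  union_mem _ _ hA hB := ⟨hA.1.union hB.1, (hA.2.and hB.2).mono fun _ h p hp x hx y hy =>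
    Or.imp (h.1 p hp x hx y hy) (h.2 p hp x hx y hy)⟩

/-- Endpoints of levels of tower `n` are multiples of `width n`, and so is `k * width N` for `n ≥
N`; hence the cut point never falls inside a level. -/
lemma Iio_mem_eventuallySaturated (N : ℕ) (k : ℤ) :
    Iio (k * c.width N) ∈ c.eventuallySaturated := by
  refine ⟨measurableSet_Iio, (eventually_ge_atTop N).mono fun n hn p hp x hx y hy h => ?_⟩
  obtain ⟨M, hM⟩ := c.exists_width_eq hn
  rw [mem_level_iff] at hx hy
  rw [mem_Iio, hM, ← mul_assoc] at h ⊢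
  have hw := c.width_pos n
  have h1 : (c.pos n p : ℝ) < k * M := lt_of_mul_lt_mul_right (hx.1.trans_lt h) hw.le
  have h2 : (c.pos n p : ℝ) + 1 ≤ k * M := by
    have : ((c.pos n p : ℤ) : ℝ) < ((k * M : ℤ) : ℝ) := by push_cast; exact h1
    have : (c.pos n p : ℤ) + 1 ≤ k * M := by exact_mod_cast this
    exact_mod_cast this
  exact hy.2.trans_le (mul_le_mul_of_nonneg_right h2 hw.le)

lemma generateFrom_eventuallySaturated :
    borel ℝ = MeasurableSpace.generateFrom c.eventuallySaturated := by
  refine le_antisymm ?_ ?_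
  · rw [borel_eq_generateFrom_Iio]
    refine MeasurableSpace.generateFrom_le ?_
    rintro _ ⟨a, rfl⟩
    -- The endpoint is the largest multiple of `width N` strictly below `a`, hence within `width N`
    -- of `a`.
    have h : Iio a = ⋃ N, Iio ((⌈a / c.width N⌉ - 1 : ℤ) * c.width N) := by
      ext x
      simp only [mem_Iio, mem_iUnion]
      constructor
      · intro hx
        obtain ⟨N, hN⟩ := (c.tendsto_width.eventually (gt_mem_nhds (sub_pos.2 hx))).exists
        refine ⟨N, ?_⟩
        have hw := c.width_pos N
        have := Int.le_ceil (a / c.width N)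
        rw [div_le_iff₀ hw] at this
        push_cast
        linarith
      · rintro ⟨N, hN⟩
        have hw := c.width_pos N
        have := Int.ceil_lt_add_one (a / c.width N)
        push_cast at hN
        rw [← sub_lt_iff_lt_add, lt_div_iff₀ hw] at this
        linarith
    rw [h]
    exact .iUnion fun N =>
      MeasurableSpace.measurableSet_generateFrom (c.Iio_mem_eventuallySaturated N _)
  · refine MeasurableSpace.generateFrom_le fun A hA => ?_
    rw [← BorelSpace.measurable_eq (α := ℝ)]
    exact hA.1

lemma measureDense_eventuallySaturated (μ : Measure ℝ) [IsFiniteMeasure μ] :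
    μ.MeasureDense c.eventuallySaturated :=
  .of_generateFrom_isSetAlgebra_finite μ c.isSetAlgebra_eventuallySaturated
    (BorelSpace.measurable_eq.trans c.generateFrom_eventuallySaturated)

lemma measure_level {n p : ℕ} (hp : p < c.height n) :
    c.measure (c.level n p) = (volume c.space)⁻¹ * ENNReal.ofReal (c.width n) := by
  rw [c.measure_apply (c.measurableSet_level n p), inter_eq_left.2, volume_level]
  exact (c.level_subset_tower hp).trans (c.tower_subset_space n)

lemma measure_inter_tower {G : Set ℝ} (hG : MeasurableSet G) (n : ℕ) :
    c.measure (G ∩ c.tower n) = ∑ j ∈ Finset.range (c.height n), c.measure (G ∩ c.level n j) := by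
  rw [tower, inter_iUnion₂, measure_biUnion_finset]
  · exact fun i hi j hj hne =>
      (c.pairwiseDisjoint_level n hi hj hne).mono inter_subset_right inter_subset_right
  · exact fun p _ => hG.inter (c.measurableSet_level _ _)

lemma measure_inter_column {G : Set ℝ} (hG : MeasurableSet G) {n i : ℕ} (hi : i < c.cuts n) :
    c.measure (G ∩ c.column n i) = ∑ j ∈ Finset.range (c.height n),
      c.measure (G ∩ c.level (n + 1) (c.colStart n i + j)) := by
  rw [column, inter_iUnion₂, measure_biUnion_finset]
  · intro j hj j' hj' hne
    simp only [Finset.coe_range, mem_Iio] at hj hj'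
    refine Set.disjoint_left.2 fun x hx hx' => hne ?_
    have := c.eq_of_mem_level (c.colStart_add_lt hi (by omega)) (c.colStart_add_lt hi (by omega))
      hx.2 hx'.2
    omega
  · exact fun p _ => hG.inter (c.measurableSet_level _ _)

variable {c} in
-- Each level of tower `n` is contained in `G` or disjoint from it, and every column takes the same
-- share of each level.
lemma Saturated.measure_inter_tower_eq {n i : ℕ} {G : Set ℝ} (hG : MeasurableSet G)
    (hs : c.Saturated n G) (hi : i < c.cuts n) :
    c.measure (G ∩ c.tower n) = c.cuts n * c.measure (G ∩ c.column n i) := by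
  rw [c.measure_inter_tower hG, c.measure_inter_column hG hi, Finset.mul_sum]
  refine Finset.sum_congr rfl fun j hj => ?_
  rw [Finset.mem_range] at hj
  by_cases h : ∃ x, x ∈ G ∩ c.level n j
  · obtain ⟨x, hxG, hx⟩ := h
    have hsub : c.level n j ⊆ G := fun y hy => hs j hj x hx y hy hxG
    rw [inter_eq_right.2 hsub, inter_eq_right.2 ((c.level_succ_subset hi hj).trans hsub),
      c.measure_level hj, c.measure_level (c.colStart_add_lt hi (by omega)), c.width_eq n,
      ENNReal.ofReal_mul (Nat.cast_nonneg _), ENNReal.ofReal_natCast]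
    ring
  · rw [not_exists] at h
    have h0 : G ∩ c.level n j = ∅ := eq_empty_of_forall_notMem h
    have h1 : G ∩ c.level (n + 1) (c.colStart n i + j) = ∅ :=
      subset_eq_empty (inter_subset_inter_right G (c.level_succ_subset hi hj)) h0
    simp [h0, h1]

/-- The part of the column `i` of tower `n` which lies in the columns of tower `n + 1` with indices
in `I`. -/
def block (n i : ℕ) (I : Finset ℕ) : Set ℝ := c.column n i ∩ ⋃ i' ∈ I, c.column (n + 1) i'

lemma measurableSet_block (n i : ℕ) (I : Finset ℕ) : MeasurableSet (c.block n i I) :=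
  (c.measurableSet_column n i).inter
    (Finset.measurableSet_biUnion _ fun _ _ => c.measurableSet_column _ _)

variable {c} in
lemma Saturated.measureReal_inter_block {n i : ℕ} {I : Finset ℕ} {G : Set ℝ}
    (hG : MeasurableSet G) (hs : c.Saturated n G) (hs' : c.Saturated (n + 1) G)
    (hi : i < c.cuts n) (hI : ∀ i' ∈ I, i' < c.cuts (n + 1)) :
    c.measure.real (G ∩ c.block n i I) =
      (I.card / c.cuts (n + 1) : ℝ) / c.cuts n * c.measure.real (G ∩ c.tower n) := by
  have hr : (c.cuts n : ℝ) ≠ 0 := by exact_mod_cast (c.cuts_pos n).ne'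
  have hr' : (c.cuts (n + 1) : ℝ) ≠ 0 := by exact_mod_cast (c.cuts_pos (n + 1)).ne'
  have hm := hG.inter (c.measurableSet_column n i)
  have h1 : c.measure.real (G ∩ c.tower n) = c.cuts n * c.measure.real (G ∩ c.column n i) := by
    simp [measureReal_def, hs.measure_inter_tower_eq hG hi]
  -- `G ∩ column n i` is saturated at stage `n + 1` and lies in tower `n + 1`, so the proportion
  -- formula applies again one stage up.
  have h2 : ∀ i' ∈ I, c.measure (G ∩ c.column n i) =
      c.cuts (n + 1) * c.measure (G ∩ c.column n i ∩ c.column (n + 1) i') := by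
    intro i' hi'
    have hsub : G ∩ c.column n i ⊆ c.tower (n + 1) :=
      inter_subset_right.trans ((c.column_subset_tower hi).trans (c.tower_mono n.le_succ))
    rw [← (hs'.inter (c.saturated_column hi)).measure_inter_tower_eq hm (hI i' hi'),
      inter_eq_left.2 hsub]
  have h3 : c.cuts (n + 1) * c.measure (G ∩ c.block n i I) =
      I.card * c.measure (G ∩ c.column n i) := by
    rw [block, ← inter_assoc, inter_iUnion₂, measure_biUnion_finset, Finset.mul_sum,
      Finset.sum_congr rfl fun i' hi' => (h2 i' hi').symm, Finset.sum_const, nsmul_eq_mul]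
    · intro i' hi' i'' hi'' hne
      refine Set.disjoint_left.2 fun x hx hx' => hne ?_
      exact c.eq_of_mem_column (hI _ hi') (hI _ hi'') hx.2 hx'.2
    · exact fun i' _ => hm.inter (c.measurableSet_column _ _)
  have h4 : c.cuts (n + 1) * c.measure.real (G ∩ c.block n i I) =
      I.card * c.measure.real (G ∩ c.column n i) := by
    simpa [measureReal_def] using congrArg ENNReal.toReal h3
  rw [h1]
  field_simp
  linarith

lemma measureReal_inter_space {G : Set ℝ} (hG : MeasurableSet G) :
    c.measure.real (G ∩ c.space) = c.measure.real G := by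
  rw [measureReal_def, c.measure_apply (hG.inter c.measurableSet_space), inter_assoc, inter_self,
    ← c.measure_apply hG, measureReal_def]

lemma tendsto_measureReal_inter_tower [IsFiniteMeasure c.measure] {G : Set ℝ}
    (hG : MeasurableSet G) :
    Tendsto (fun n => c.measure.real (G ∩ c.tower n)) atTop (𝓝 (c.measure.real G)) := by
  have h := tendsto_measure_iUnion_atTop (μ := c.measure) (s := fun n => G ∩ c.tower n)
    (fun m n hmn => inter_subset_inter_right G (c.tower_mono hmn))
  rw [← inter_iUnion, ← space_eq_iUnion_tower] at h
  rw [← c.measureReal_inter_space hG]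
  exact (ENNReal.tendsto_toReal (measure_ne_top _ _)).comp h

/-- For eventually saturated sets this follows from the exact proportion formula, as the towers
exhaust the space. Both sides are 1-Lipschitz for the measure of the symmetric difference, so
density extends it to all measurable sets. -/
lemma tendsto_measureReal_inter_block [IsFiniteMeasure c.measure] {n : ℕ → ℕ} {r i : ℕ} {α : ℝ}
    {I : ℕ → Finset ℕ} (hn : Tendsto n atTop atTop) (hcuts : ∀ k, c.cuts (n k) = r) (hi : i < r)
    (hI : ∀ k, ∀ i' ∈ I k, i' < c.cuts (n k + 1))
    (hα : Tendsto (fun k => ((I k).card : ℝ) / c.cuts (n k + 1)) atTop (𝓝 α))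
    {G : Set ℝ} (hG : MeasurableSet G) :
    Tendsto (fun k => c.measure.real (G ∩ c.block (n k) i (I k))) atTop
      (𝓝 (α / r * c.measure.real G)) := by
  have hα1 : ∀ k, ((I k).card : ℝ) / c.cuts (n k + 1) ≤ 1 := fun k => by
    refine div_le_one_of_le₀ ?_ (Nat.cast_nonneg _)
    have : I k ⊆ Finset.range (c.cuts (n k + 1)) := fun i' hi' => Finset.mem_range.2 (hI k i' hi')
    exact_mod_cast (Finset.card_le_card this).trans_eq (Finset.card_range _)
  have h0 : 0 ≤ α := ge_of_tendsto' hα fun k => by positivity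
  have hr : (1 : ℝ) ≤ r := by exact_mod_cast (show 1 ≤ r by omega)
  have h1 : α / r ≤ 1 :=
    div_le_one_of_le₀ ((le_of_tendsto' hα hα1).trans hr) (Nat.cast_nonneg _)
  refine tendsto_of_measureDense (K := 1) (c.measureDense_eventuallySaturated c.measure)
    (F := fun k G => c.measure.real (G ∩ c.block (n k) i (I k)))
    (L := fun G => α / r * c.measure.real G) ?_ ?_ ?_ hG
  · intro k A B _ _
    rw [one_mul]
    refine (abs_measureReal_sub_le _ _ _).trans (measureReal_mono ?_)
    rw [← inter_symmDiff_distrib_right]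
    exact inter_subset_left
  · intro A B _ _
    rw [← mul_sub, abs_mul, abs_of_nonneg (by positivity)]
    exact mul_le_mul h1 (abs_measureReal_sub_le _ _ _) (abs_nonneg _) zero_le_one
  · intro A hA
    have hlim := (hα.div_const (r : ℝ)).mul ((c.tendsto_measureReal_inter_tower hA.1).comp hn)
    refine hlim.congr' ?_
    filter_upwards [hn.eventually hA.2, ((tendsto_add_atTop_nat 1).comp hn).eventually hA.2]
      with k hs hs'
    rw [hs.measureReal_inter_block hA.1 hs' (by rwa [hcuts]) (hI k), hcuts]
    rfl

/-! ### Return lags: how `T^q` and `T^{2q}` move the levels. -/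

/-- The part of the level `j` of tower `n` in the column `i` of tower `n` and in the column `i'` of
tower `n + 1`. -/
def cell (n i' i j : ℕ) : Set ℝ :=
  c.level (n + 2) (c.colStart (n + 1) i' + (c.colStart n i + j))

lemma cell_subset_level {n i' i j : ℕ} (hi' : i' < c.cuts (n + 1)) (hi : i < c.cuts n)
    (hj : j < c.height n) : c.cell n i' i j ⊆ c.level n j :=
  (c.level_succ_subset hi' (c.colStart_add_lt hi (by omega))).trans (c.level_succ_subset hi hj)

lemma exists_mem_cell {n i j : ℕ} {I : Finset ℕ} {x : ℝ} (hI : ∀ i' ∈ I, i' < c.cuts (n + 1))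
    (hi : i < c.cuts n) (hj : j < c.height n) (hx : x ∈ c.level n j) (hx' : x ∈ c.block n i I) :
    ∃ i' ∈ I, x ∈ c.cell n i' i j := by
  obtain ⟨hx1, hx2⟩ := hx'
  simp only [mem_iUnion] at hx2
  obtain ⟨i', hi', hx2⟩ := hx2
  exact ⟨i', hi', c.mem_level_succ_of_mem_column (hI _ hi') (c.colStart_add_lt hi (by omega))
    (c.mem_level_succ_of_mem_column hi hj hx hx1) hx2⟩

/-- The passage from a column to the next one. -/
lemma iterate_map_mem_cell {n i' i j : ℕ} {x : ℝ} (hi' : i' < c.cuts (n + 1))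
    (hi : i + 1 < c.cuts n) (hj : j < c.height n) (hs : c.spacers n i ≤ j)
    (hx : x ∈ c.cell n i' i j) :
    c.map^[c.height n] x ∈ c.cell n i' (i + 1) (j - c.spacers n i) := by
  -- The next column begins `height n + spacers n i` higher, so `height n` steps fall short of level
  -- `j` by the number of spacers; `hs` keeps the image out of the spacers.
  have hidx : c.colStart (n + 1) i' + (c.colStart n i + j) + c.height n =
      c.colStart (n + 1) i' + (c.colStart n (i + 1) + (j - c.spacers n i)) := by
    rw [colStart_succ]
    omega
  have hlt : c.colStart n (i + 1) + (j - c.spacers n i) < c.height (n + 1) :=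
    c.colStart_add_lt hi (by omega)
  have hlt' := c.colStart_add_lt (n := n + 1) hi' (Nat.lt_add_right _ hlt)
  have := c.iterate_map_mem_level (a := c.height n) (by rwa [hidx]) hx
  rwa [hidx] at this

/-- The passage from the last column of tower `n` to the first one, in the next column of tower
`n + 1`. -/
lemma iterate_map_mem_cell_of_last {n i' i j : ℕ} {x : ℝ} (hi' : i' + 1 < c.cuts (n + 1))
    (hi : i + 1 = c.cuts n) (hj : j < c.height n)
    (hs : c.spacers n i + c.spacers (n + 1) i' ≤ j) (hx : x ∈ c.cell n i' i j) :
    c.map^[c.height n] x ∈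
      c.cell n (i' + 1) 0 (j - (c.spacers n i + c.spacers (n + 1) i')) := by
  have hh : c.colStart n i + (c.height n + c.spacers n i) = c.height (n + 1) := by
    rw [← colStart_succ, hi, colStart_cuts]
  have hidx : c.colStart (n + 1) i' + (c.colStart n i + j) + c.height n =
      c.colStart (n + 1) (i' + 1) +
        (c.colStart n 0 + (j - (c.spacers n i + c.spacers (n + 1) i'))) := by
    rw [colStart_succ, colStart_zero]
    omega
  have hlt : c.colStart n 0 + (j - (c.spacers n i + c.spacers (n + 1) i')) < c.height (n + 1) :=
    c.colStart_add_lt (c.cuts_pos n) (by omega)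
  have hlt' := c.colStart_add_lt (n := n + 1) hi' (Nat.lt_add_right _ hlt)
  have := c.iterate_map_mem_level (a := c.height n) (by rwa [hidx]) hx
  rwa [hidx] at this

/-- The return lag of the column `i` among `r` columns, when `e` spacers follow the last one. -/
def lag (r i e : ℕ) : ℕ := (if r / 2 ≤ i then 1 else 0) + if i + 1 = r then e else 0

/-- The sum of the return lags of the column `i` and of the column which follows it. -/
def lagTwo (r i e : ℕ) : ℕ := lag r i e + if i + 1 < r then lag r (i + 1) e else 0

lemma lagTwo_le {r i e : ℕ} (he : e ≤ 1) : lagTwo r i e ≤ 3 := by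
  simp only [lagTwo, lag]
  split_ifs <;> omega

lemma lag_le_lagTwo (r i e : ℕ) : lag r i e ≤ lagTwo r i e := Nat.le_add_right _ _

lemma iterate_map_mem_cell_lag {n i' i j e : ℕ} {x : ℝ}
    (hs : ∀ i < c.cuts n, c.spacers n i = if c.cuts n / 2 ≤ i then 1 else 0)
    (hi' : i' + 1 < c.cuts (n + 1)) (he : c.spacers (n + 1) i' = e) (hi : i < c.cuts n)
    (hj : j < c.height n) (hj' : lag (c.cuts n) i e ≤ j) (hx : x ∈ c.cell n i' i j) :
    c.map^[c.height n] x ∈ if i + 1 < c.cuts n then c.cell n i' (i + 1) (j - lag (c.cuts n) i e)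
      else c.cell n (i' + 1) 0 (j - lag (c.cuts n) i e) := by
  split_ifs with h
  · have hl : lag (c.cuts n) i e = c.spacers n i := by
      rw [lag, if_neg (by omega : ¬ i + 1 = c.cuts n), hs i hi, add_zero]
    rw [hl] at hj' ⊢
    exact c.iterate_map_mem_cell (by omega) h hj hj' hx
  · have h' : i + 1 = c.cuts n := by omega
    have hl : lag (c.cuts n) i e = c.spacers n i + c.spacers (n + 1) i' := by
      rw [lag, if_pos h', hs i hi, he]
    rw [hl] at hj' ⊢
    exact c.iterate_map_mem_cell_of_last hi' h' hj hj' hx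

lemma iterate_height_mem_level {n i' i j e : ℕ} {x : ℝ}
    (hs : ∀ i < c.cuts n, c.spacers n i = if c.cuts n / 2 ≤ i then 1 else 0)
    (hi' : i' + 1 < c.cuts (n + 1)) (he : c.spacers (n + 1) i' = e) (hi : i < c.cuts n)
    (hj : j < c.height n) (hj' : lag (c.cuts n) i e ≤ j) (hx : x ∈ c.cell n i' i j) :
    c.map^[c.height n] x ∈ c.level n (j - lag (c.cuts n) i e) := by
  have h := c.iterate_map_mem_cell_lag hs hi' he hi hj hj' hx
  split_ifs at h with h1
  · exact c.cell_subset_level (by omega) h1 (by omega) h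
  · exact c.cell_subset_level hi' (c.cuts_pos n) (by omega) h

lemma iterate_two_mul_height_mem_level {n i' i j e : ℕ} {x : ℝ}
    (hs : ∀ i < c.cuts n, c.spacers n i = if c.cuts n / 2 ≤ i then 1 else 0)
    (hi' : i' + 1 < c.cuts (n + 1)) (he : c.spacers (n + 1) i' = e) (hi : i < c.cuts n)
    (hj : j < c.height n) (hj' : lagTwo (c.cuts n) i e ≤ j) (hx : x ∈ c.cell n i' i j) :
    c.map^[2 * c.height n] x ∈ c.level n (j - lagTwo (c.cuts n) i e) := by
  have hl := lag_le_lagTwo (c.cuts n) i e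
  have h := c.iterate_map_mem_cell_lag hs hi' he hi hj (hl.trans hj') hx
  rw [two_mul, Function.iterate_add_apply]
  rw [lagTwo] at hj' hl ⊢
  split_ifs at h hj' ⊢ with h1
  · have := c.iterate_height_mem_level hs hi' he h1 (by omega) (by omega) h
    rwa [Nat.sub_sub] at this
  -- After the last column the orbit is in column `0`, over which there is no spacer: the second lag
  -- is `0`, as in `lagTwo`.
  · have h2 := c.two_le_cuts n
    have h0 : c.spacers n 0 = 0 := by
      rw [hs 0 (by omega), if_neg (by omega)]
    have := c.cell_subset_level hi' (by omega) (by omega)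
      (c.iterate_map_mem_cell hi' (by omega) (by omega) (by omega) h)
    rwa [h0, Nat.sub_zero] at this

/-! ### Computation of the limit joining. -/

/-- If `f k` acts on the block as `b` steps down in tower `n k` (up to a displacement inside the
levels), then it is asymptotically the `b`-th power of the inverse there. -/
lemma tendsto_measureReal_symmDiff_inter [IsFiniteMeasure c.measure] {n : ℕ → ℕ}
    (hn : Tendsto n atTop atTop) {f : ℕ → ℝ → ℝ} {b m : ℕ} {Y : ℕ → Set ℝ} (hbm : b ≤ m)
    (hf : ∀ k, MeasurePreserving (f k) c.measure c.measure)
    (hY : ∀ k, Y k ⊆ c.tower (n k))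
    (hfY : ∀ k j x, m ≤ j → j < c.height (n k) → x ∈ c.level (n k) j → x ∈ Y k →
      f k x ∈ c.level (n k) (j - b)) {A : Set ℝ} (hA : MeasurableSet A) :
    Tendsto (fun k => c.measure.real (((f k ⁻¹' A) ∆ (c.inv^[b] ⁻¹' A)) ∩ Y k)) atTop (𝓝 0) := by
  have hinv := c.isAutomorphismWithInverse.measurePreserving_inverse.iterate b
  refine tendsto_of_measureDense (K := 2) (c.measureDense_eventuallySaturated c.measure)
    (F := fun k A => c.measure.real (((f k ⁻¹' A) ∆ (c.inv^[b] ⁻¹' A)) ∩ Y k))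
    (L := fun _ => 0) ?_ ?_ ?_ hA
  · intro k A B hA hB
    refine (abs_measureReal_sub_le _ _ _).trans ?_
    -- The constant `2` counts the two measure-preserving maps `f k` and `inv^[b]`.
    calc _ ≤ c.measure.real (f k ⁻¹' (A ∆ B) ∪ c.inv^[b] ⁻¹' (A ∆ B)) := by
          refine measureReal_mono fun x hx => ?_
          simp only [mem_symmDiff, mem_inter_iff, mem_union, mem_preimage] at hx ⊢
          tauto
      _ ≤ _ := measureReal_union_le _ _
      _ = _ := by
          have hAB : MeasurableSet (A ∆ B) := hA.symmDiff hB
          rw [measureReal_def, measureReal_def, (hf k).measure_preimage hAB.nullMeasurableSet,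
            hinv.measure_preimage hAB.nullMeasurableSet, ← two_mul, measureReal_def]
  · intro A B _ _
    simp [measureReal_nonneg]
  · intro A hA
    have hlim : Tendsto
        (fun k => (m : ℝ) * (((volume c.space)⁻¹).toReal * c.width (n k))) atTop (𝓝 0) := by
      simpa using ((c.tendsto_width.comp hn).const_mul ((volume c.space)⁻¹).toReal).const_mul (m : ℝ)
    refine squeeze_zero' (.of_forall fun _ => measureReal_nonneg) ?_ hlim
    have hheight : Tendsto (fun k => c.height (n k)) atTop atTop :=
      tendsto_atTop_mono (fun k => (Nat.lt_two_pow_self).le.trans (c.two_pow_le_height (n k))) hn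
    filter_upwards [hn.eventually hA.2, hheight.eventually_ge_atTop m] with k hs hm
    -- Above the lowest `m` levels, `f k x` and `inv^[b] x` lie in the same level, which the
    -- saturated set `A` cannot separate. Only those `m` levels contribute.
    calc _ ≤ c.measure.real (⋃ j ∈ Finset.range m, c.level (n k) j) := by
          refine measureReal_mono (fun x ⟨hx, hxY⟩ => ?_) (measure_ne_top _ _)
          obtain ⟨j, hj, hxj⟩ := c.mem_tower.1 (hY k hxY)
          by_contra hx'
          simp only [mem_iUnion, Finset.mem_range, not_exists] at hx'
          have hmj : m ≤ j := not_lt.1 fun h => hx' j h hxj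
          have h1 := hfY k j x hmj hj hxj hxY
          have h2 : c.inv^[b] x ∈ c.level (n k) (j - b) :=
            c.iterate_inv_mem_level (by omega) (by rwa [Nat.sub_add_cancel (by omega)])
          rcases hx with ⟨h, h'⟩ | ⟨h, h'⟩
          · exact h' (hs _ (by omega) _ h1 _ h2 h)
          · exact h' (hs _ (by omega) _ h2 _ h1 h)
      _ ≤ ∑ j ∈ Finset.range m, c.measure.real (c.level (n k) j) :=
          measureReal_biUnion_finset_le _ _
      _ = _ := by
          rw [Finset.sum_congr rfl fun j hj => ?_, Finset.sum_const, Finset.card_range,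
            nsmul_eq_mul]
          have := Finset.mem_range.1 hj
          rw [measureReal_def, c.measure_level (by omega), ENNReal.toReal_mul,
            ENNReal.toReal_ofReal (c.width_pos _).le]

/-- The columns among `r` columns, other than the last one, over which `e` spacers are put. -/
def half (r e : ℕ) : Finset ℕ := if e = 0 then Finset.range (r / 2) else Finset.Ico (r / 2) (r - 1)

lemma of_mem_half {r e i : ℕ} (hr : 2 ≤ r) (he : e ≤ 1) (hi : i ∈ half r e) :
    i + 1 < r ∧ (if r / 2 ≤ i then 1 else 0) = e := by
  rw [half] at hi
  split_ifs at hi with h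
  · rw [Finset.mem_range] at hi
    rw [if_neg (by omega)]
    omega
  · rw [Finset.mem_Ico] at hi
    rw [if_pos hi.1]
    omega

lemma tendsto_card_half {r : ℕ → ℕ} (hr : Tendsto r atTop atTop) (e : ℕ) :
    Tendsto (fun k => ((half (r k) e).card : ℝ) / r k) atTop (𝓝 (1 / 2)) := by
  have hr' : Tendsto (fun k => (r k : ℝ)) atTop atTop := tendsto_natCast_atTop_atTop.comp hr
  have hz : Tendsto (fun k => 2 / (r k : ℝ)) atTop (𝓝 0) := hr'.const_div_atTop 2
  rw [← tendsto_sub_nhds_zero_iff]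
  refine squeeze_zero_norm' ?_ hz
  filter_upwards [hr.eventually_ge_atTop 2] with k hk
  have hpos : (0 : ℝ) < r k := by exact_mod_cast (show 0 < r k by omega)
  -- Rounding in `r / 2` and the omitted last column change the cardinality by a bounded amount; the
  -- slack `4` yields the error `2 / r`.
  have h1 : 2 * (half (r k) e).card ≤ r k ∧ r k ≤ 2 * (half (r k) e).card + 4 := by
    rw [half]
    split_ifs
    · rw [Finset.card_range]
      omega
    · rw [Nat.card_Ico]
      omega
  have h2 : 2 * ((half (r k) e).card : ℝ) ≤ r k := by exact_mod_cast h1.1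
  have h3 : (r k : ℝ) ≤ 2 * ((half (r k) e).card : ℝ) + 4 := by exact_mod_cast h1.2
  rw [Real.norm_eq_abs, abs_le]
  constructor
  · rw [neg_le_sub_iff_le_add, ← add_div, div_le_div_iff₀ two_pos hpos]
    linarith
  · rw [sub_le_iff_le_add, ← sub_le_iff_le_add', ← sub_div, div_le_div_iff₀ hpos two_pos]
    nlinarith

lemma sum_lag {r : ℕ} (hr : 4 ≤ r) (hreven : Even r) (g : ℕ → ℕ → ℝ) :
    ∑ s ∈ Finset.range r ×ˢ Finset.range 2,
        1 / 2 / (r : ℝ) * g (lagTwo r s.1 s.2) (lag r s.1 s.2) =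
      ((r : ℝ) - 2) / (2 * r) * g 0 0 + 1 / (2 * (r : ℝ)) * g 1 1 + 1 / (2 * (r : ℝ)) * g 2 2
        + 1 / (r : ℝ) * g 1 0 + ((r : ℝ) - 3) / (2 * r) * g 2 1 + 1 / (2 * (r : ℝ)) * g 3 1 := by
  -- With `r = 2u + 4`, the pairs (`lagTwo`, `lag`) are: `(0, 0)` on the first `u + 1` columns, `(1,
  -- 0)` on the last column of the left half, `(2, 1)` on the next `u`, then `(2 + e, 1)` and `(1 +
  -- e, 1 + e)` on the last two.
  obtain ⟨u, rfl⟩ : ∃ u, r = u + 1 + 1 + u + 1 + 1 := by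
    obtain ⟨t, rfl⟩ := hreven
    exact ⟨t - 2, by omega⟩
  set r := u + 1 + 1 + u + 1 + 1 with hru
  have hhalf : r / 2 = u + 2 := by omega
  have hR : (r : ℝ) = 2 * u + 4 := by rw [hru]; push_cast; ring
  have hpos : (0 : ℝ) < 2 * u + 4 := by positivity
  rw [← Finset.mul_sum, Finset.sum_product]
  have h1 : ∀ i ∈ Finset.range (u + 1), ∑ e ∈ Finset.range 2, g (lagTwo r i e) (lag r i e) =
      2 * g 0 0 := by
    intro i hi
    rw [Finset.mem_range] at hi
    have h : ∀ e, lagTwo r i e = 0 ∧ lag r i e = 0 := fun e => by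
      simp only [lagTwo, lag, hhalf]
      split_ifs <;> omega
    simp only [h, Finset.sum_const, Finset.card_range, nsmul_eq_mul, Nat.cast_ofNat]
  have h2 : ∑ e ∈ Finset.range 2, g (lagTwo r (u + 1) e) (lag r (u + 1) e) = 2 * g 1 0 := by
    have h : ∀ e, lagTwo r (u + 1) e = 1 ∧ lag r (u + 1) e = 0 := fun e => by
      simp only [lagTwo, lag, hhalf]
      split_ifs <;> omega
    simp only [h, Finset.sum_const, Finset.card_range, nsmul_eq_mul, Nat.cast_ofNat]
  have h3 : ∀ i ∈ Finset.range u, ∑ e ∈ Finset.range 2,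
      g (lagTwo r (u + 1 + 1 + i) e) (lag r (u + 1 + 1 + i) e) = 2 * g 2 1 := by
    intro i hi
    rw [Finset.mem_range] at hi
    have h : ∀ e, lagTwo r (u + 1 + 1 + i) e = 2 ∧ lag r (u + 1 + 1 + i) e = 1 := fun e => by
      simp only [lagTwo, lag, hhalf]
      split_ifs <;> omega
    simp only [h, Finset.sum_const, Finset.card_range, nsmul_eq_mul, Nat.cast_ofNat]
  have h4 : ∑ e ∈ Finset.range 2, g (lagTwo r (u + 1 + 1 + u) e) (lag r (u + 1 + 1 + u) e) =
      g 2 1 + g 3 1 := by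
    have h : ∀ e, lagTwo r (u + 1 + 1 + u) e = 2 + e ∧ lag r (u + 1 + 1 + u) e = 1 := fun e => by
      simp only [lagTwo, lag, hhalf]
      split_ifs <;> omega
    simp only [h, Finset.sum_range_succ, Finset.sum_range_zero, zero_add, add_zero]
  have h5 : ∑ e ∈ Finset.range 2, g (lagTwo r (u + 1 + 1 + u + 1) e) (lag r (u + 1 + 1 + u + 1) e) =
      g 1 1 + g 2 2 := by
    have h : ∀ e, lagTwo r (u + 1 + 1 + u + 1) e = 1 + e ∧ lag r (u + 1 + 1 + u + 1) e = 1 + e :=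
      fun e => by
        simp only [lagTwo, lag, hhalf]
        split_ifs <;> omega
    simp only [h, Finset.sum_range_succ, Finset.sum_range_zero, zero_add, add_zero]
  have hsplit : ∀ f : ℕ → ℝ, ∑ i ∈ Finset.range r, f i = ∑ i ∈ Finset.range (u + 1), f i + f (u + 1)
      + ∑ i ∈ Finset.range u, f (u + 1 + 1 + i) + f (u + 1 + 1 + u) + f (u + 1 + 1 + u + 1) := by
    intro f
    rw [hru, Finset.sum_range_succ, Finset.sum_range_succ, Finset.sum_range_add,
      Finset.sum_range_succ]
  rw [hsplit, Finset.sum_congr rfl h1, h2, Finset.sum_congr rfl h3, h4, h5, Finset.sum_const,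
    Finset.sum_const, Finset.card_range, Finset.card_range, nsmul_eq_mul, nsmul_eq_mul, hR]
  push_cast
  field_simp
  ring

lemma disjoint_block {n r' : ℕ} {i e i₁ e₁ : ℕ} (hr' : c.cuts (n + 1) = r') (hi : i < c.cuts n)
    (hi₁ : i₁ < c.cuts n) (he : e ≤ 1) (he₁ : e₁ ≤ 1) (h : (i, e) ≠ (i₁, e₁)) :
    Disjoint (c.block n i (half r' e)) (c.block n i₁ (half r' e₁)) := by
  subst hr'
  have hr := c.two_le_cuts (n + 1)
  refine Set.disjoint_left.2 fun x hx hx' => h ?_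
  obtain ⟨hx1, hx2⟩ := hx
  obtain ⟨hx1', hx2'⟩ := hx'
  simp only [mem_iUnion] at hx2 hx2'
  obtain ⟨j, hj, hx2⟩ := hx2
  obtain ⟨j', hj', hx2'⟩ := hx2'
  have h1 := of_mem_half hr he hj
  have h1' := of_mem_half hr he₁ hj'
  obtain rfl := c.eq_of_mem_column hi hi₁ hx1 hx1'
  obtain rfl := c.eq_of_mem_column (by omega) (by omega) hx2 hx2'
  rw [← h1.2, ← h1'.2]

/-- On the block `(i, e)` the two powers of `map` act asymptotically as fixed powers of `inv`, and
the block samples every measurable set with weight `1 / (2r)`. -/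
theorem tendsto_measureReal_preimage_iterate (hfin : volume c.space ≠ ⊤)
    {r : ℕ} (hr : 4 ≤ r) {n : ℕ → ℕ} (hn : StrictMono n)
    (hcuts : ∀ k, c.cuts (n k) = r)
    (hcuts' : Tendsto (fun k => c.cuts (n k + 1)) atTop atTop)
    (hspacers : ∀ k, ∀ i < c.cuts (n k),
      c.spacers (n k) i = if c.cuts (n k) / 2 ≤ i then 1 else 0)
    (hspacers' : ∀ k, ∀ i < c.cuts (n k + 1),
      c.spacers (n k + 1) i = if c.cuts (n k + 1) / 2 ≤ i then 1 else 0)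
    {A B C : Set ℝ} (hA : MeasurableSet A) (hB : MeasurableSet B) (hC : MeasurableSet C) :
    Tendsto (fun k => c.measure.real (c.map^[2 * c.height (n k)] ⁻¹' A ∩
        c.map^[c.height (n k)] ⁻¹' B ∩ C)) atTop
      (𝓝 (∑ s ∈ Finset.range r ×ˢ Finset.range 2, 1 / 2 / (r : ℝ) *
        c.measure.real (c.inv^[lagTwo r s.1 s.2] ⁻¹' A ∩ c.inv^[lag r s.1 s.2] ⁻¹' B ∩ C))) := by
  have := c.isProbabilityMeasure_measure hfin
  have hn' := hn.tendsto_atTop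
  have haut := c.isAutomorphismWithInverse
  have hs : ∀ s : ℕ × ℕ, s ∈ Finset.range r ×ˢ Finset.range 2 → s.1 < r ∧ s.2 ≤ 1 := by
    intro s hs
    rw [Finset.mem_product, Finset.mem_range, Finset.mem_range] at hs
    omega
  set Y : ℕ → ℕ × ℕ → Set ℝ := fun k s => c.block (n k) s.1 (half (c.cuts (n k + 1)) s.2) with hYdef
  have hblock : ∀ s ∈ Finset.range r ×ˢ Finset.range 2, ∀ G : Set ℝ, MeasurableSet G →
      Tendsto (fun k => c.measure.real (G ∩ Y k s)) atTop
        (𝓝 (1 / 2 / r * c.measure.real G)) := fun s hs' G hG =>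
    c.tendsto_measureReal_inter_block hn' hcuts (hs s hs').1
      (fun k i' hi' => by
        have := of_mem_half (c.two_le_cuts _) (hs s hs').2 hi'
        omega)
      (tendsto_card_half hcuts' s.2) hG
  have hYt : ∀ k, ∀ s ∈ Finset.range r ×ˢ Finset.range 2, Y k s ⊆ c.tower (n k) := fun k s hs' =>
    inter_subset_left.trans (c.column_subset_tower (by rw [hcuts]; exact (hs s hs').1))
  -- The bound `3` is the largest value of `lagTwo`: from level `3` on, the orbit never drops below
  -- the bottom level.
  have hcell : ∀ k, ∀ s ∈ Finset.range r ×ˢ Finset.range 2, ∀ j x, 3 ≤ j → j < c.height (n k) →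
      x ∈ c.level (n k) j → x ∈ Y k s →
        c.map^[c.height (n k)] x ∈ c.level (n k) (j - lag r s.1 s.2) ∧
        c.map^[2 * c.height (n k)] x ∈ c.level (n k) (j - lagTwo r s.1 s.2) := by
    intro k s hs' j x hj hj' hx hxY
    obtain ⟨hi, he⟩ := hs s hs'
    rw [← hcuts k] at hi
    have hmem := fun i' hi' => of_mem_half (i := i') (c.two_le_cuts (n k + 1)) he hi'
    obtain ⟨i', hi', hx'⟩ := c.exists_mem_cell
      (fun i' hi' => (Nat.lt_succ_self i').trans (hmem i' hi').1) hi hj' hx hxY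
    have hsp : c.spacers (n k + 1) i' = s.2 := by
      rw [hspacers' k i' ((Nat.lt_succ_self i').trans (hmem i' hi').1), (hmem i' hi').2]
    have h3 := lagTwo_le (r := c.cuts (n k)) (i := s.1) he
    have h3' := lag_le_lagTwo (c.cuts (n k)) s.1 s.2
    rw [← hcuts k]
    exact ⟨c.iterate_height_mem_level (hspacers k) (hmem i' hi').1 hsp hi hj' (by omega) hx',
      c.iterate_two_mul_height_mem_level (hspacers k) (hmem i' hi').1 hsp hi hj' (by omega) hx'⟩
  refine tendsto_measureReal_of_partition (μ := c.measure) _ (Y := Y)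
    (M := fun _ => 1 / 2 / (r : ℝ)) (fun k s _ => c.measurableSet_block _ _ _) ?_ ?_ ?_ ?_ ?_
  · intro k s hs' s₁ hs₁ hne
    have h := hs s hs'
    have h₁ := hs s₁ hs₁
    exact c.disjoint_block rfl (by rw [hcuts]; exact h.1) (by rw [hcuts]; exact h₁.1) h.2 h₁.2 hne
  · exact fun k => (((c.measurable_map.iterate _) hA).inter ((c.measurable_map.iterate _) hB)).inter
      hC
  · intro s hs'
    have h3 := lagTwo_le (r := r) (i := s.1) (hs s hs').2
    have h3' := lag_le_lagTwo r s.1 s.2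
    have hG : MeasurableSet
        (c.inv^[lagTwo r s.1 s.2] ⁻¹' A ∩ c.inv^[lag r s.1 s.2] ⁻¹' B ∩ C) :=
      (((c.measurable_inv.iterate _) hA).inter ((c.measurable_inv.iterate _) hB)).inter hC
    have hlimA := c.tendsto_measureReal_symmDiff_inter hn' h3
      (fun k => haut.measurePreserving.iterate (2 * c.height (n k))) (fun k => hYt k s hs')
      (fun k j x hj hj' hx hxY => (hcell k s hs' j x hj hj' hx hxY).2) hA
    have hlimB := c.tendsto_measureReal_symmDiff_inter hn' (h3'.trans h3)
      (fun k => haut.measurePreserving.iterate (c.height (n k))) (fun k => hYt k s hs')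
      (fun k j x hj hj' hx hxY => (hcell k s hs' j x hj hj' hx hxY).1) hB
    have hlim := hlimA.add hlimB
    rw [add_zero] at hlim
    -- Within the block, the two triple intersections differ only where the preimages of `A` or
    -- those of `B` do.
    refine tendsto_of_tendsto_of_dist (hblock s hs' _ hG) (squeeze_zero (fun _ => dist_nonneg)
      (fun k => ?_) hlim)
    rw [Real.dist_eq]
    refine (abs_measureReal_sub_le _ _ _).trans ((measureReal_mono fun x hx => ?_).trans
      (measureReal_union_le _ _))
    simp only [mem_symmDiff, mem_inter_iff, mem_union, mem_preimage] at hx ⊢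
    tauto
  · intro s hs'
    simpa using hblock s hs' univ .univ
  · have : (r : ℝ) ≠ 0 := by exact_mod_cast (show r ≠ 0 by omega)
    rw [Finset.sum_const, Finset.card_product, Finset.card_range, Finset.card_range, nsmul_eq_mul]
    push_cast
    field_simp

end CutStack

/-! ### Reversing symmetries and non-reversibility. -/

lemma offDiagonalJoining_real_prod {X : Type*} [MeasurableSpace X] {μ : Measure X} {S₁ S₂ : X → X}
    (h₁ : Measurable S₁) (h₂ : Measurable S₂) {A B C : Set X} (hA : MeasurableSet A)
    (hB : MeasurableSet B) (hC : MeasurableSet C) :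
    (offDiagonalJoining μ S₁ S₂).real (A ×ˢ B ×ˢ C) = μ.real (S₁ ⁻¹' A ∩ S₂ ⁻¹' B ∩ C) := by
  rw [offDiagonalJoining, measureReal_def, Measure.map_apply (by fun_prop) (by measurability),
    measureReal_def]
  congr 2
  ext x
  simp [and_assoc]

/-- The relation `T S T = S` expresses reversal without the inverse; its innermost copy inside
`T^{m+1} S T^{m+1}` collapses, leaving `T^m S T^m`. -/
lemma ae_iterate_reversing {X : Type*} [MeasurableSpace X] {μ : Measure X} {T S : X → X}
    (hT : MeasurePreserving T μ μ) (h : T ∘ S ∘ T =ᵐ[μ] S) (m : ℕ) :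
    ∀ᵐ x ∂μ, T^[m] (S (T^[m] x)) = S x := by
  induction m with
  | zero => exact .of_forall fun _ => rfl
  | succ m ih =>
    filter_upwards [ih, (hT.iterate m).quasiMeasurePreserving.ae h] with x hx hx'
    rw [Function.iterate_succ_apply' T m x, Function.iterate_succ_apply T m]
    simp only [Function.comp_apply] at hx'
    rw [hx', hx]

/-- Conjugation by a map which reverses `T` exchanges the first and the third factor. -/
lemma measureReal_preimage_iterate_of_reversing {X : Type*} [MeasurableSpace X] {μ : Measure X}
    {T S : X → X} (hT : MeasurePreserving T μ μ) (hS : MeasurePreserving S μ μ)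
    (h : T ∘ S ∘ T =ᵐ[μ] S) (q : ℕ) {A B C : Set X} (hA : MeasurableSet A)
    (hB : MeasurableSet B) (hC : MeasurableSet C) :
    μ.real (T^[2 * q] ⁻¹' (S ⁻¹' A) ∩ T^[q] ⁻¹' (S ⁻¹' B) ∩ S ⁻¹' C) =
      μ.real (T^[2 * q] ⁻¹' C ∩ T^[q] ⁻¹' B ∩ A) := by
  have hiter := ae_iterate_reversing hT h
  have hE : MeasurableSet (T^[2 * q] ⁻¹' C ∩ T^[q] ⁻¹' B ∩ A) :=
    (((hT.measurable.iterate _) hC).inter ((hT.measurable.iterate _) hB)).inter hA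
  -- Change of variables `y = S (T^{2q} x)`: then `T^{2q} y = S x` and `T^q y = S (T^q x)`.
  have hST := hS.comp (hT.iterate (2 * q))
  rw [measureReal_def, measureReal_def, ← hST.measure_preimage hE.nullMeasurableSet]
  congr 1
  refine measure_congr ?_
  filter_upwards [hiter (2 * q), (hT.iterate q).quasiMeasurePreserving.ae (hiter q)] with x h1 h2
  refine propext ?_
  change (S (T^[2 * q] x) ∈ A ∧ S (T^[q] x) ∈ B) ∧ S x ∈ C ↔
    (T^[2 * q] (S (T^[2 * q] x)) ∈ C ∧ T^[q] (S (T^[2 * q] x)) ∈ B) ∧ S (T^[2 * q] x) ∈ A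
  rw [h1, two_mul, Function.iterate_add_apply, h2]
  tauto

namespace CutStack

variable (c : CutStack)

/-- A reversing `S` would force the term `(2, 2)`, of weight `1 / (2r)`, to be matched by a term
`(2, 0)`, which is absent. -/
theorem not_isReversible (hfin : volume c.space ≠ ⊤)
    {r : ℕ} (hr : 4 ≤ r) {n : ℕ → ℕ}
    (hlim : ∀ A B C : Set ℝ, MeasurableSet A → MeasurableSet B → MeasurableSet C →
      Tendsto (fun k => c.measure.real (c.map^[2 * c.height (n k)] ⁻¹' A ∩
        c.map^[c.height (n k)] ⁻¹' B ∩ C)) atTop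
      (𝓝 (((r : ℝ) - 2) / (2 * r) * c.measure.real (c.inv^[0] ⁻¹' A ∩ c.inv^[0] ⁻¹' B ∩ C)
        + 1 / (2 * (r : ℝ)) * c.measure.real (c.inv^[1] ⁻¹' A ∩ c.inv^[1] ⁻¹' B ∩ C)
        + 1 / (2 * (r : ℝ)) * c.measure.real (c.inv^[2] ⁻¹' A ∩ c.inv^[2] ⁻¹' B ∩ C)
        + 1 / (r : ℝ) * c.measure.real (c.inv^[1] ⁻¹' A ∩ c.inv^[0] ⁻¹' B ∩ C)
        + ((r : ℝ) - 3) / (2 * r) * c.measure.real (c.inv^[2] ⁻¹' A ∩ c.inv^[1] ⁻¹' B ∩ C)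
        + 1 / (2 * (r : ℝ)) * c.measure.real (c.inv^[3] ⁻¹' A ∩ c.inv^[1] ⁻¹' B ∩ C)))) :
    ¬ IsReversible c.measure c.map := by
  rintro ⟨T', S, hT', hS, -, hTS⟩
  have := c.isProbabilityMeasure_measure hfin
  have haut := c.isAutomorphismWithInverse
  have hT := haut.measurePreserving
  have hconj : c.map ∘ S ∘ c.map =ᵐ[c.measure] S := by
    filter_upwards [hT.quasiMeasurePreserving.ae hTS, hT'.left_inverse] with x h1 h2
    simp only [Function.comp_apply, id_eq] at h1 h2 ⊢
    rw [h1, h2]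
  -- Tower `2` has at least `4` levels, enough to tell apart levels `0`, `1` and `2`.
  have hq := c.two_pow_le_height 2
  norm_num at hq
  set L : ℕ → Set ℝ := c.level 2
  have hLm : ∀ p, MeasurableSet (L p) := c.measurableSet_level 2
  have hrpos : (0 : ℝ) < r := by exact_mod_cast (show 0 < r by omega)
  have hr3 : (0 : ℝ) ≤ (r : ℝ) - 3 := by
    have : (4 : ℝ) ≤ r := by exact_mod_cast hr
    linarith
  -- Along the sequence, the triple `(S⁻¹ L 2, S⁻¹ L 2, S⁻¹ L 0)` has the same measures as `(L 0, L
  -- 2, L 2)`, so the two limits agree.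
  have hl := hlim _ _ _ (hS.measurable (hLm 2)) (hS.measurable (hLm 2)) (hS.measurable (hLm 0))
  simp only [measureReal_preimage_iterate_of_reversing hT hS hconj _ (hLm 2) (hLm 2) (hLm 0)] at hl
  have heq := tendsto_nhds_unique hl (hlim _ _ _ (hLm 0) (hLm 2) (hLm 2))
  have hstep : ∀ p a x, p + a < 4 → x ∈ L (p + a) → c.inv^[a] x ∈ L p :=
    fun p a x h hx => c.iterate_inv_mem_level (by omega) hx
  have hne : ∀ p p' x, p < 4 → p' < 4 → x ∈ L p → x ∈ L p' → p = p' :=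
    fun p p' x hp hp' => c.eq_of_mem_level (by omega) (by omega)
  -- From level `2`, `a` steps down reach level `0` only for `a = 2`, and `b` steps down stay in
  -- level `2` only for `b = 0`.
  have hzero : ∀ a b, a ≤ 2 → b ≤ 2 → (a ≠ 2 ∨ b ≠ 0) →
      c.measure.real (c.inv^[a] ⁻¹' L 0 ∩ c.inv^[b] ⁻¹' L 2 ∩ L 2) = 0 := by
    intro a b ha hb hab
    rw [eq_empty_of_forall_notMem (s := _ ∩ _ ∩ _), measureReal_empty]
    rintro x ⟨⟨h0, h2⟩, hx⟩
    have ha' := hne _ _ _ (by omega) (by omega) h0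
      (hstep (2 - a) a x (by omega) (by rwa [Nat.sub_add_cancel ha]))
    have hb' := hne _ _ _ (by omega) (by omega) h2
      (hstep (2 - b) b x (by omega) (by rwa [Nat.sub_add_cancel hb]))
    omega
  -- Three steps down leave the tower, but the middle factor already excludes `b = 1`.
  have hthree : c.measure.real (c.inv^[3] ⁻¹' L 0 ∩ c.inv^[1] ⁻¹' L 2 ∩ L 2) = 0 := by
    rw [eq_empty_of_forall_notMem (s := _ ∩ _ ∩ _), measureReal_empty]
    rintro x ⟨⟨-, h2⟩, hx⟩
    have := hne _ _ _ (by omega) (by omega) h2 (hstep 1 1 x (by omega) hx)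
    omega
  rw [hzero 0 0, hzero 1 1, hzero 2 2, hzero 1 0, hzero 2 1, hthree] at heq <;> try omega
  -- If `S x ∈ L 0`, then `S (T^{-2} x) = T^2 (S x) ∈ L 2`, so the `(2, 2)` term is the measure of
  -- all of `S⁻¹ L 0`, that is, of a level.
  have hpos : 0 < c.measure.real
      (c.inv^[2] ⁻¹' (S ⁻¹' L 2) ∩ c.inv^[2] ⁻¹' (S ⁻¹' L 2) ∩ S ⁻¹' L 0) := by
    have hinv := haut.measurePreserving_inverse
    have hae : (S ⁻¹' L 0 : Set ℝ) ≤ᵐ[c.measure]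
        (c.inv^[2] ⁻¹' (S ⁻¹' L 2) ∩ c.inv^[2] ⁻¹' (S ⁻¹' L 2) ∩ S ⁻¹' L 0 : Set ℝ) := by
      filter_upwards [haut.right_inverse, hinv.quasiMeasurePreserving.ae haut.right_inverse,
        (hinv.iterate 2).quasiMeasurePreserving.ae (ae_iterate_reversing hT hconj 2)]
        with x h1 h2 h3 hx
      have h4 : c.map^[2] (c.inv^[2] x) = x := by
        simp only [Function.comp_apply, id_eq] at h1 h2
        simp only [Function.iterate_succ, Function.iterate_zero, Function.comp_apply, id_eq, h1, h2]
      rw [h4] at h3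
      have h5 : S (c.inv^[2] x) ∈ L 2 := by
        rw [← h3]
        exact c.iterate_map_mem_level (n := 2) (p := 0) (a := 2) (by omega) hx
      exact ⟨⟨h5, h5⟩, hx⟩
    refine ENNReal.toReal_pos (ne_of_gt (lt_of_lt_of_le ?_ (measure_mono_ae hae)))
      (measure_ne_top _ _)
    rw [hS.measure_preimage (hLm 0).nullMeasurableSet, c.measure_level (by omega)]
    exact ENNReal.mul_pos (ENNReal.inv_ne_zero.2 hfin)
      (ENNReal.ofReal_pos.2 (c.width_pos 2)).ne'
  have hnn : ∀ a b, 0 ≤ c.measure.real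
      (c.inv^[a] ⁻¹' (S ⁻¹' L 2) ∩ c.inv^[b] ⁻¹' (S ⁻¹' L 2) ∩ S ⁻¹' L 0) :=
    fun _ _ => measureReal_nonneg
  have hr2 : (0 : ℝ) ≤ (r : ℝ) - 2 := by linarith
  refine heq.not_gt ?_
  have h00 := mul_nonneg (div_nonneg hr2 (by positivity : 0 ≤ 2 * (r : ℝ))) (hnn 0 0)
  have h11 := mul_nonneg (by positivity : 0 ≤ 1 / (2 * (r : ℝ))) (hnn 1 1)
  have h22 := mul_pos (by positivity : 0 < 1 / (2 * (r : ℝ))) hpos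
  have h10 := mul_nonneg (by positivity : 0 ≤ 1 / (r : ℝ)) (hnn 1 0)
  have h21 := mul_nonneg (div_nonneg hr3 (by positivity : 0 ≤ 2 * (r : ℝ))) (hnn 2 1)
  have h31 := mul_nonneg (by positivity : 0 ≤ 1 / (2 * (r : ℝ))) (hnn 3 1)
  simp only [mul_zero, add_zero]
  linarith

end CutStack

end

theorem mainTheorem8 (c : CutStack) (hfin : volume c.space ≠ ⊤)
    (r : ℕ) (hr : 4 ≤ r) (hreven : Even r)
    (n : ℕ → ℕ) (hn : StrictMono n)
    (hcuts : ∀ k, c.cuts (n k) = r)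
    (hcuts' : Tendsto (fun k => c.cuts (n k + 1)) atTop atTop)
    (hspacers : ∀ k, ∀ i < c.cuts (n k),
      c.spacers (n k) i = if c.cuts (n k) / 2 ≤ i then 1 else 0)
    (hspacers' : ∀ k, ∀ i < c.cuts (n k + 1),
      c.spacers (n k + 1) i = if c.cuts (n k + 1) / 2 ≤ i then 1 else 0) :
    ¬ IsReversible c.measure c.map ∧
    ∃ T' : ℝ → ℝ, IsAutomorphismWithInverse c.measure c.map T' ∧
      ∀ A B C : Set ℝ, MeasurableSet A → MeasurableSet B → MeasurableSet C →
        Tendsto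
          (fun k => (offDiagonalJoining c.measure (c.map^[2 * c.height (n k)])
            (c.map^[c.height (n k)])).real (A ×ˢ B ×ˢ C))
          atTop
          (𝓝 (((r : ℝ) - 2) / (2 * r)
                * (offDiagonalJoining c.measure T'^[0] T'^[0]).real (A ×ˢ B ×ˢ C)
            + 1 / (2 * (r : ℝ))
                * (offDiagonalJoining c.measure T'^[1] T'^[1]).real (A ×ˢ B ×ˢ C)
            + 1 / (2 * (r : ℝ))
                * (offDiagonalJoining c.measure T'^[2] T'^[2]).real (A ×ˢ B ×ˢ C)
            + 1 / (r : ℝ)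
                * (offDiagonalJoining c.measure T'^[1] T'^[0]).real (A ×ˢ B ×ˢ C)
            + ((r : ℝ) - 3) / (2 * r)
                * (offDiagonalJoining c.measure T'^[2] T'^[1]).real (A ×ˢ B ×ˢ C)
            + 1 / (2 * (r : ℝ))
                * (offDiagonalJoining c.measure T'^[3] T'^[1]).real (A ×ˢ B ×ˢ C))) := by
  have haut := c.isAutomorphismWithInverse
  have hlim := fun A B C hA hB hC => CutStack.sum_lag hr hreven
    (fun a b => c.measure.real (c.inv^[a] ⁻¹' A ∩ c.inv^[b] ⁻¹' B ∩ C)) ▸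
    c.tendsto_measureReal_preimage_iterate hfin hr hn hcuts hcuts' hspacers hspacers'
      (A := A) (B := B) (C := C) hA hB hC
  refine ⟨c.not_isReversible hfin hr hlim, c.inv, haut, fun A B C hA hB hC => ?_⟩
  have hT := fun m => c.measurable_map.iterate m
  have hI := fun m => c.measurable_inv.iterate m
  simp only [offDiagonalJoining_real_prod (hT _) (hT _) hA hB hC,
    offDiagonalJoining_real_prod (hI _) (hI _) hA hB hC]
  exact hlim A B C hA hB hC
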